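/- Let $q$ be a power of a prime $p\neq 3$, and let $L/\mathbb{F}_q(x)$ be a separable cubic extension generated by an element $y$ with $y^3-3y-a=0$, $a\in\mathbb{F}_q(x)$ (every impure cubic extension is of this form). Write $a=\alpha/(\gamma^3\beta)$ with $\alpha,\beta,\gamma\in\mathbb{F}_q[x]$, $\gamma\ne 0$, $(\alpha,\beta\gamma)=1$, $\beta$ cube-free, and $\beta=\beta_1\beta_2^2$ with $\beta_1,\beta_2\in\mathbb{F}_q[x]$ square-free. Put $\omega=\gamma\beta_1\beta_2 y$. Let $\mathcal{O}$ be the integral closure of $\mathbb{F}_q[x]$ in $L$, and let $\partial$ be the finite discriminant of $L/\mathbb{F}_q(x)$, i.e. the norm to $\mathbb{F}_q[x]$ of the different of $\mathcal{O}/\mathbb{F}_q[x]$. For $\theta\in\mathcal{O}$ with minimal polynomial $X^3+bX^2+cX+d$ let $\Delta(\theta)=b^2c^2-4c^3-4b^3d-27d^2+18bcd$, and let $\mathrm{Ind}(\theta)$ be the ideal of $\mathbb{F}_q[x]$ defined by $(\Delta(\theta))=\mathrm{Ind}(\theta)^2\,\partial$. For a finite place $\mathfrak p$ of $\mathbb{F}_q(x)$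 (a nonzero prime ideal of $\mathbb{F}_q[x]$) let $v_{\mathfrak p}$ be the corresponding valuation. Then $\omega$ is integral over $\mathbb{F}_q[x]$, and the following hold. (a) If $p\neq 2$ and $4\gamma^6\beta^2-\alpha^2=\eta_1\eta_2^2$ with $\eta_1,\eta_2\in\mathbb{F}_q[x]$ and $\eta_1$ square-free, then $$\partial=\big((\beta_1\beta_2)^2\eta_1\big)\quad\text{and}\quad \mathrm{Ind}(\omega)=(\beta_1\eta_2).$$ (b) If $p=2$, let $r$ be a root of the quadratic resolvent $X^2+3aX+(9a^2-27)=X^2+aX+(a^2+1)$ of $X^3-3X-a$. There are $\eta\in\mathbb{F}_q(x)$ and $z$ with $\mathbb{F}_q(x,z)=\mathbb{F}_q(x,r)$ and $$z^2-z=b,\qquad b=\frac1{a^2}+1+\eta^2-\eta,$$ in global standard form: each finite place $\mathfrak p$ of $\mathbb{F}_q(x)$ that ramifies in $\mathbb{F}_q(x,r)$ satisfies $v_{\mathfrak p}(b)<0$ and $(v_{\mathfrak p}(b),2)=1$, and each $\mathfrak p\mid(\alpha)$ that is unramified in $\mathbb{F}_q(x,r)$ satisfies $v_{\mathfrak p}(b)\ge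 0$. For every such $\eta$ and $z$, put $\ell_{\mathfrak p}=-v_{\mathfrak p}(b)$ if $\mathfrak p\mid(\alpha)$ is ramified in $\mathbb{F}_q(x,r)$, and $\ell_{\mathfrak p}=-1$ if $\mathfrak p\mid(\alpha)$ is unramified there. Then $$\partial=\big((\beta_1\beta_2)^2\big)\prod_{\substack{(v_{\mathfrak p}(b),2)=1\\ v_{\mathfrak p}(b)<0}}\mathfrak p^{\ell_{\mathfrak p}+1}\quad\text{and}\quad \mathrm{Ind}(\omega)=(\beta_1)\prod_{\mathfrak p\mid(\alpha)}\mathfrak p^{\,v_{\mathfrak p}(\alpha)-\frac12(\ell_{\mathfrak p}+1)}.$$ -/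

import Mathlib

open Polynomial IsDedekindDomain
open scoped nonZeroDivisors

namespace CubicFF

noncomputable section

/-- The order `v_𝔭(f) ∈ ℤ` of a rational function `f` at a finite place `𝔭` of `F(x)`, that is, at a
nonzero prime ideal of `F[x]`. (By convention the value at `f = 0` is the integer `0`; below, orders
of a function that may vanish only occur in the conditions `v_𝔭(f) ≥ 0` and `v_𝔭(f) < 0`, whose
truth values for `f = 0` are those given by `v_𝔭(0) = ∞`.) -/
def ord {F : Type*} [Field F] (v : HeightOneSpectrum F[X]) (f : RatFunc F) : ℤ :=
  -WithZero.log (v.valuation (RatFunc F) f)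

/-- The discriminant ideal of `L / F(x)` over `F[x]`: the relative norm to `F[x]` of the different
ideal of the integral closure of `F[x]` in `L`. -/
def discriminantIdeal (F : Type*) [Field F] (L : Type*) [Field L] [Algebra F[X] L]
    [Algebra (RatFunc F) L] [IsScalarTower F[X] (RatFunc F) L]
    [FiniteDimensional (RatFunc F) L] [Algebra.IsSeparable (RatFunc F) L] : Ideal F[X] :=
  haveI : Module.Finite F[X] (integralClosure F[X] L) :=
    IsIntegralClosure.finite F[X] (RatFunc F) L (integralClosure F[X] L)
  haveI : IsDedekindDomain (integralClosure F[X] L) :=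
    integralClosure.isDedekindDomain F[X] (RatFunc F) L
  haveI : FaithfulSMul F[X] L := FaithfulSMul.trans F[X] (RatFunc F) L
  Ideal.relNorm F[X] (differentIdeal F[X] (integralClosure F[X] L))

/-- The discriminant `b²c² - 4c³ - 4b³d - 27d² + 18bcd` of a monic cubic `X³ + bX² + cX + d`. -/
def cubicDiscr {R : Type*} [CommRing R] (f : R[X]) : R :=
  f.coeff 2 ^ 2 * f.coeff 1 ^ 2 - 4 * f.coeff 1 ^ 3 - 4 * f.coeff 2 ^ 3 * f.coeff 0
    - 27 * f.coeff 0 ^ 2 + 18 * f.coeff 2 * f.coeff 1 * f.coeff 0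

/-- The discriminant `Δ(ω) ∈ F[x]` of an element `ω` of a cubic extension of `F(x)` that is integral
over `F[x]` and of degree three. -/
def elementDiscr (F : Type*) [Field F] {L : Type*} [Field L] [Algebra F[X] L] (ω : L) : F[X] :=
  cubicDiscr (minpoly F[X] ω)

/-- `I` is the ideal `Ind(ω)`, determined by `(Δ(ω)) = Ind(ω)² ∂`, where `∂` is the discriminant
ideal. -/
def IsInd {F : Type*} [Field F] {L : Type*} [Field L] [Algebra F[X] L]
    [Algebra (RatFunc F) L] [IsScalarTower F[X] (RatFunc F) L]
    [FiniteDimensional (RatFunc F) L] [Algebra.IsSeparable (RatFunc F) L]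
    (ω : L) (I : Ideal F[X]) : Prop :=
  Ideal.span {elementDiscr F ω} = I ^ 2 * discriminantIdeal F L

/-- The quadratic resolvent `X² + (bc - 3d) X + (b³d + c³ - 6bcd + 9d²)` of a monic cubic
`X³ + bX² + cX + d`. If `t₁, t₂, t₃` are the roots of the cubic, its roots are
`t₁²t₂ + t₂²t₃ + t₃²t₁` and `t₂²t₁ + t₃²t₂ + t₁²t₃`. -/
def quadraticResolvent {K : Type*} [Field K] (f : K[X]) : K[X] :=
  X ^ 2 + C (f.coeff 2 * f.coeff 1 - 3 * f.coeff 0) * X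
    + C (f.coeff 2 ^ 3 * f.coeff 0 + f.coeff 1 ^ 3
      - 6 * f.coeff 2 * f.coeff 1 * f.coeff 0 + 9 * f.coeff 0 ^ 2)

/-- The finite place `v` of `F(x)` ramifies in the extension `Q` of `F(x)`. -/
def Ramifies {F : Type*} [Field F] (v : HeightOneSpectrum F[X]) (Q : Type*) [Field Q]
    [Algebra F[X] Q] : Prop :=
  ∃ P : Ideal (integralClosure F[X] Q),
    P.IsPrime ∧ P.LiesOver v.asIdeal ∧ 1 < P.ramificationIdx F[X]

/-- The function `b = 1/a² + 1 + η² - η`. -/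
def asFun {F : Type*} [Field F] (a η : RatFunc F) : RatFunc F :=
  1 / a ^ 2 + 1 + η ^ 2 - η

/-- `z` is an Artin-Schreier generator of `Q / F(x)` with `z² - z = b = 1/a² + 1 + η² - η`, in global
standard form with respect to the finite places: at every ramified finite place `b` has a pole of
odd order, and at every unramified place dividing `α` it has no pole. -/
structure IsGlobalStandardForm {F : Type*} [Field F] {Q : Type*} [Field Q] [Algebra F[X] Q]
    [Algebra (RatFunc F) Q] (a : RatFunc F) (α : F[X]) (η : RatFunc F) (z : Q) : Prop where
  adjoin_eq_top : IntermediateField.adjoin (RatFunc F) {z} = ⊤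
  equation : z ^ 2 - z = algebraMap (RatFunc F) Q (asFun a η)
  ramified : ∀ v : HeightOneSpectrum F[X], Ramifies v Q →
    ord v (asFun a η) < 0 ∧ Odd (ord v (asFun a η))
  unramified : ∀ v : HeightOneSpectrum F[X], α ∈ v.asIdeal → ¬ Ramifies v Q →
    0 ≤ ord v (asFun a η)

open scoped Classical in
/-- The integer `ℓ_𝔭`: it is `-v_𝔭(b)` if `𝔭` ramifies in `Q`, and `-1` if it does not. -/
def ell {F : Type*} [Field F] (v : HeightOneSpectrum F[X]) (Q : Type*) [Field Q]
    [Algebra F[X] Q] (b : RatFunc F) : ℤ :=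
  if Ramifies v Q then -ord v b else -1

end

end CubicFF

namespace CubicFF

section

/-! Both formulas are equalities of ideals of `F[x]`, so it suffices to compare orders at every
finite place `v` (`eq_of_count_eq`, `eq_of_count_coeIdeal_eq`). The element ω is a root of X³ −
3(γβ₁β₂)²X − β₁²β₂α, hence Δ(ω) = 27β₁⁴β₂²D with D = 4γ⁶β² − α² and 27 a unit. Once the order of ∂
is known at each place, that of Ind(ω) is half the difference, so the real work is the order of ∂.

Two criteria supply it. If θ is a root of X³ + t₂X² + πt₁X + πt₀ with t₀ a unit at v, then θ
generates the integers at v and ∂ has the order of the discriminant of this cubic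
(`count_differentIdeal_of_eisenstein_or_partial`); t₂ may be a unit, in which case only a quadratic
factor is Eisenstein. If 1, θ, W are integral at v with unit discriminant, then ∂ has order 0
(`count_differentIdeal_eq_zero`).

It remains to exhibit elements. At β₂ take ω and at β₁ take ω²/β₁: both are Eisenstein and tame,
giving order 2. Where neither β nor D vanishes take 1, ω, ω². For p ≠ 2 and πⁿ exactly dividing D
with n > 0, one has a = 2ε + πⁿ·unit with ε = ±1, and Y = y + ε satisfies Y²(Y − 3ε) = a − 2ε;
dividing Y(Y − 3ε) by π to the power ⌊n/2⌋ leads to order n mod 2.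

For p = 2, D = α² and Y = y + 1 satisfies Y²(Y + 1) = a. With e = 1 + aη the identity e² + ae + a² +
a = a²b links the cubic to the resolvent, and (Y + 1)(Y + e), divided by a or by a power of π,
yields order 0 or ℓ + 1. Ramification in the resolvent field is read off from b by Artin–Schreier
theory, and a standard form exists because the residue fields are perfect. -/

/-- The discriminant of the cubic `X³ + bX² + cX + d`, as a function of its coefficients. -/
def disc3 {R : Type*} [CommRing R] (b c d : R) : R :=
  b ^ 2 * c ^ 2 - 4 * c ^ 3 - 4 * b ^ 3 * d - 27 * d ^ 2 + 18 * b * c * d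

/-- The cubic equation satisfied by `p + qY + rY²` when `Y³ + aY² + bY + c = 0`. -/
theorem cubic_of_quadratic_combination {R : Type*} [CommRing R] {p q r Y a b c : R}
    (h : Y ^ 3 + a * Y ^ 2 + b * Y + c = 0) :
    (p + q * Y + r * Y ^ 2) ^ 3
      + -(3 * p - q * a + r * (a ^ 2 - 2 * b)) * (p + q * Y + r * Y ^ 2) ^ 2
      + (3 * p ^ 2 + 2 * p * (-q * a + r * (a ^ 2 - 2 * b)) + q ^ 2 * b + q * r * (3 * c - a * b)
          + r ^ 2 * (b ^ 2 - 2 * a * c)) * (p + q * Y + r * Y ^ 2)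
      + -(p ^ 3 - p ^ 2 * q * a + p ^ 2 * r * (a ^ 2 - 2 * b) + p * q ^ 2 * b
          + p * q * r * (3 * c - a * b) + p * r ^ 2 * (b ^ 2 - 2 * a * c) - q ^ 3 * c
          + q ^ 2 * r * (a * c) - q * r ^ 2 * (b * c) + r ^ 3 * c ^ 2) = 0 := by
  -- The cofactor is the quotient of the left side by the given cubic, as polynomials in `Y`.
  linear_combination (r ^ 3 * Y ^ 3 + 3 * q * r ^ 2 * Y ^ 2 - r ^ 3 * Y ^ 2 * a + 3 * q ^ 2 * r * Y
    - 2 * q * r ^ 2 * Y * a + r ^ 3 * Y * b + q ^ 3 - q ^ 2 * r * a + q * r ^ 2 * b - r ^ 3 * c) * h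

/-! ### Cubic field extensions: power basis, norm and discriminant -/

section CubicField

variable {K L : Type*} [Field K] [Field L] [Algebra K L]

theorem monic_cubic (b c d : K) : (X ^ 3 + C b * X ^ 2 + C c * X + C d : K[X]).Monic := by
  monicity!

theorem natDegree_cubic (b c d : K) :
    (X ^ 3 + C b * X ^ 2 + C c * X + C d : K[X]).natDegree = 3 := by
  compute_degree!

theorem natDegree_minpoly_eq_three (h3 : Module.finrank K L = 3) {θ : L}
    (hθ : θ ∉ Set.range (algebraMap K L)) : (minpoly K θ).natDegree = 3 := by
  have : FiniteDimensional K L := Module.finite_of_finrank_pos (by omega)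
  have hd := minpoly.degree_dvd (K := K) (Algebra.IsIntegral.isIntegral θ)
  rw [h3] at hd
  rcases (Nat.dvd_prime Nat.prime_three).1 hd with h | h
  · exact absurd ((minpoly.natDegree_eq_one_iff).1 h) hθ
  · exact h

theorem minpoly_eq_cubic (h3 : Module.finrank K L = 3) {θ : L}
    (hθ : θ ∉ Set.range (algebraMap K L)) {b c d : K}
    (h : θ ^ 3 + algebraMap K L b * θ ^ 2 + algebraMap K L c * θ + algebraMap K L d = 0) :
    minpoly K θ = X ^ 3 + C b * X ^ 2 + C c * X + C d := by
  have : FiniteDimensional K L := Module.finite_of_finrank_pos (by omega)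
  have hi : IsIntegral K θ := Algebra.IsIntegral.isIntegral θ
  refine (Polynomial.eq_of_monic_of_dvd_of_natDegree_le (minpoly.monic hi) (monic_cubic b c d)
    (minpoly.dvd K θ ?_) ?_).symm
  · simpa using h
  · rw [natDegree_minpoly_eq_three h3 hθ, natDegree_cubic]

theorem algebra_adjoin_eq_top (h3 : Module.finrank K L = 3) {θ : L}
    (hθ : θ ∉ Set.range (algebraMap K L)) : Algebra.adjoin K {θ} = ⊤ := by
  have : FiniteDimensional K L := Module.finite_of_finrank_pos (by omega)
  have hi : IsIntegral K θ := Algebra.IsIntegral.isIntegral θ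
  rw [← IntermediateField.adjoin_simple_toSubalgebra_of_isAlgebraic hi.isAlgebraic,
    ← IntermediateField.top_toSubalgebra, (Field.primitive_element_iff_minpoly_natDegree_eq K θ).2]
  rw [natDegree_minpoly_eq_three h3 hθ, h3]

theorem exists_basis_pow (h3 : Module.finrank K L = 3) {θ : L}
    (hθ : θ ∉ Set.range (algebraMap K L)) :
    ∃ B : Module.Basis (Fin 3) K L, ∀ i, B i = θ ^ (i : ℕ) := by
  have hli := linearIndependent_pow (K := K) θ
  rw [natDegree_minpoly_eq_three h3 hθ] at hli
  exact ⟨basisOfLinearIndependentOfCardEqFinrank hli (by simp [h3]), fun i => by simp⟩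

theorem leftMulMatrix_cubic {B : Module.Basis (Fin 3) K L} {θ : L} (hB : ∀ i, B i = θ ^ (i : ℕ))
    {b c d : K}
    (h : θ ^ 3 + algebraMap K L b * θ ^ 2 + algebraMap K L c * θ + algebraMap K L d = 0) :
    Algebra.leftMulMatrix B θ = !![0, 0, -d; 1, 0, -c; 0, 1, -b] := by
  have h0 : θ * B 0 = B 1 := by simp [hB]
  have h1 : θ * B 1 = B 2 := by simp [hB, pow_two]
  have h2 : θ * B 2 = -d • B 0 + -c • B 1 + -b • B 2 := by
    simp only [hB, Algebra.smul_def]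
    simp
    linear_combination h
  ext i j
  rw [Algebra.leftMulMatrix_eq_repr_mul]
  fin_cases j
  · simp only [Fin.zero_eta, h0]
    fin_cases i <;> simp
  · simp only [Fin.mk_one, h1]
    fin_cases i <;> simp
  · simp only [Fin.reduceFinMk, h2]
    fin_cases i <;> simp

variable (h3 : Module.finrank K L = 3) {θ : L} (hθ : θ ∉ Set.range (algebraMap K L)) {b c d : K}
    (h : θ ^ 3 + algebraMap K L b * θ ^ 2 + algebraMap K L c * θ + algebraMap K L d = 0)

include h3 hθ h

theorem norm_gen_cubic : Algebra.norm K θ = -d := by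
  obtain ⟨B, hB⟩ := exists_basis_pow h3 hθ
  rw [Algebra.norm_eq_matrix_det B, leftMulMatrix_cubic hB h, Matrix.det_fin_three]
  simp

/-- The sign is (−1)^(n(n−1)/2) for n = 3. -/
theorem norm_derivative_cubic :
    Algebra.norm K (3 * θ ^ 2 + 2 * algebraMap K L b * θ + algebraMap K L c) = -disc3 b c d := by
  obtain ⟨B, hB⟩ := exists_basis_pow h3 hθ
  rw [Algebra.norm_eq_matrix_det B]
  have : (3 * θ ^ 2 + 2 * algebraMap K L b * θ + algebraMap K L c)
      = (3 : K) • θ ^ 2 + (2 * b) • θ + c • 1 := by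
    simp [Algebra.smul_def, map_ofNat]
  rw [this, map_add, map_add, map_smul, map_smul, map_smul, map_pow, map_one,
    leftMulMatrix_cubic hB h, Matrix.det_fin_three]
  simp [pow_two, disc3]
  ring

theorem discr_cubic : Algebra.discr K (fun i : Fin 3 => θ ^ (i : ℕ)) = disc3 b c d := by
  obtain ⟨B, hB⟩ := exists_basis_pow h3 hθ
  -- Power sums of the conjugates are traces of powers of the companion matrix, which turns the
  -- trace determinant into a polynomial identity.
  have key (n : ℕ) : Algebra.trace K L (θ ^ n)
      = ((!![0, 0, -d; 1, 0, -c; 0, 1, -b] : Matrix (Fin 3) (Fin 3) K) ^ n).trace := by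
    rw [Algebra.trace_eq_matrix_trace B, map_pow, leftMulMatrix_cubic hB h]
  rw [Algebra.discr_def, Matrix.det_fin_three]
  simp only [Algebra.traceMatrix_apply, Algebra.traceForm_apply, ← pow_add, key]
  simp [Matrix.trace_fin_three, pow_succ, disc3]
  ring

theorem disc3_ne_zero_of_isSeparable [Algebra.IsSeparable K L] : disc3 b c d ≠ 0 := by
  have : FiniteDimensional K L := Module.finite_of_finrank_pos (by omega)
  obtain ⟨B, hB⟩ := exists_basis_pow h3 hθ
  rw [← discr_cubic h3 hθ h, ← funext hB]
  exact Algebra.discr_not_zero_of_basis K B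

end CubicField

end

section

/-! ### Maximality at π of the order generated by a partially Eisenstein element -/

section Maximality

variable {A B : Type*} [CommRing A] [IsDomain A] [CommRing B] [Algebra A B]

theorem dvd_of_algebraMap_mul [IsPrincipalIdealRing A] {π c : A} (hπ : Prime π) (hc : ¬ π ∣ c) {z : B}
    (h : algebraMap A B π ∣ algebraMap A B c * z) : algebraMap A B π ∣ z := by
  obtain ⟨s, t, hst⟩ := (hπ.irreducible.coprime_iff_not_dvd).2 hc
  have := congrArg (algebraMap A B) hst
  simp only [map_add, map_mul, map_one] at this
  obtain ⟨w, hw⟩ := h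
  exact ⟨algebraMap A B s * z + algebraMap A B t * w, by
    linear_combination (-z) * this + algebraMap A B t * hw⟩

variable {π f₀ f₁ f₂ : A} (hπ : Prime π) (hf₀ : ¬ π ∣ f₀) {x : B}
  (hx : x ^ 3 + algebraMap A B f₂ * x ^ 2 + algebraMap A B (π * f₁) * x
    + algebraMap A B (π * f₀) = 0)
  (N : B →* A) (hN : ∀ c, N (algebraMap A B c) = c ^ 3) (hNx : N x = -(π * f₀))

include hπ hf₀ hN hNx

/-- Norms of x² = πw would give π²f₀² = π³N(w), so that π divides f₀. -/
theorem not_dvd_sq_of_norm : ¬ algebraMap A B π ∣ x ^ 2 := by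
  rintro ⟨w, hw⟩
  have h := congrArg N hw
  rw [map_pow, map_mul, hNx, hN] at h
  have h2 : f₀ ^ 2 = π * N w := mul_left_cancel₀ (pow_ne_zero 2 hπ.ne_zero) (by linear_combination h)
  exact hf₀ (hπ.dvd_of_dvd_pow ⟨_, h2⟩)

variable [IsDomain B] [FaithfulSMul A B]

include hx

-- The cubic reads x·x(x + f₂) = −π(f₁x + f₀). If x(x + f₂) = πw, cancelling π gives x(w + f₁) =
-- −f₀; since π divides N(x), it would divide f₀³.
omit [IsDomain A] in
theorem not_dvd_mul_add_of_norm : ¬ algebraMap A B π ∣ x * (x + algebraMap A B f₂) := by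
  rintro ⟨w, hw⟩
  have hπB : algebraMap A B π ≠ 0 := by
    rw [Ne, FaithfulSMul.algebraMap_eq_zero_iff]; exact hπ.ne_zero
  simp only [map_mul] at hx
  have h : x * (w + algebraMap A B f₁) = algebraMap A B (-f₀) := by
    apply mul_left_cancel₀ hπB
    rw [map_neg]
    linear_combination hx - x * hw
  have h2 := congrArg N h
  rw [map_mul, hNx, hN] at h2
  exact hf₀ (hπ.dvd_of_dvd_pow (n := 3) ⟨f₀ * N (w + algebraMap A B f₁), by linear_combination h2⟩)

/-- If `x` is a root of a cubic `X³ + f₂X² + πf₁X + πf₀` with `π ∤ f₀`, then `A[x]` is maximal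
at `π`. -/
theorem dvd_coeffs_of_dvd_combination [IsPrincipalIdealRing A] {c₀ c₁ c₂ : A}
    (h : algebraMap A B π ∣ algebraMap A B c₀ + algebraMap A B c₁ * x + algebraMap A B c₂ * x ^ 2) :
    π ∣ c₀ ∧ π ∣ c₁ ∧ π ∣ c₂ := by
  have hsq := not_dvd_sq_of_norm hπ hf₀ N hN hNx
  have hlin := not_dvd_mul_add_of_norm hπ hf₀ hx N hN hNx
  have cancel : ∀ (c : A) (z : B), ¬ algebraMap A B π ∣ z →
      algebraMap A B π ∣ algebraMap A B c * z → π ∣ c := fun c z hz hcz => by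
    by_contra hc; exact hz (dvd_of_algebraMap_mul hπ hc hcz)
  simp only [map_mul] at hx
  obtain ⟨w, hw⟩ := h
  -- Modulo π the cubic says x³ ≡ −f₂x², so multiplying the relation by x² leaves a scalar multiple
  -- of x².
  have hg : π ∣ c₀ - c₁ * f₂ + c₂ * f₂ ^ 2 := by
    refine cancel _ _ hsq ⟨w * x ^ 2 + algebraMap A B c₁ * (algebraMap A B f₁ * x + algebraMap A B f₀)
      - algebraMap A B c₂ * (algebraMap A B f₂ * (algebraMap A B f₁ * x + algebraMap A B f₀)
        - algebraMap A B f₁ * x ^ 2 - algebraMap A B f₀ * x), ?_⟩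
    simp only [map_add, map_sub, map_mul, map_pow]
    linear_combination x ^ 2 * hw - (algebraMap A B c₁ + algebraMap A B c₂ * x
      - algebraMap A B c₂ * algebraMap A B f₂) * hx
  -- Modulo π, x(x + f₂) is annihilated by x, so multiplying by it leaves only the term in c₀.
  have h₀ : π ∣ c₀ := by
    refine cancel _ _ hlin ⟨w * (x * (x + algebraMap A B f₂)) + (algebraMap A B c₁
      + algebraMap A B c₂ * x) * (algebraMap A B f₁ * x + algebraMap A B f₀), ?_⟩
    linear_combination x * (x + algebraMap A B f₂) * hw
      - (algebraMap A B c₁ + algebraMap A B c₂ * x) * hx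
  obtain ⟨d₀, rfl⟩ := h₀
  rw [map_mul] at hw
  have h₁₂ : π ∣ f₂ * (c₁ - c₂ * f₂) := by
    have : f₂ * (c₁ - c₂ * f₂) = π * d₀ - (π * d₀ - c₁ * f₂ + c₂ * f₂ ^ 2) := by ring
    rw [this]
    exact dvd_sub (dvd_mul_right _ _) hg
  refine ⟨dvd_mul_right _ _, ?_⟩
  -- If f₂ ≡ 0 then x³ ≡ 0, and multiplying by x isolates c₁x². Otherwise c₁ ≡ c₂f₂ and what is left
  -- of the relation is c₂x(x + f₂) ≡ 0.
  by_cases hf₂ : π ∣ f₂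
  · obtain ⟨s, rfl⟩ := hf₂
    have hc₁ : π ∣ c₁ := by
      refine cancel _ _ hsq ⟨w * x - algebraMap A B d₀ * x + algebraMap A B c₂ *
        (algebraMap A B s * x ^ 2 + algebraMap A B f₁ * x + algebraMap A B f₀), ?_⟩
      simp only [map_mul] at hx
      linear_combination x * hw - algebraMap A B c₂ * hx
    obtain ⟨d₁, rfl⟩ := hc₁
    rw [map_mul] at hw
    refine ⟨dvd_mul_right _ _, cancel _ _ hsq ⟨w - algebraMap A B d₀ - algebraMap A B d₁ * x, ?_⟩⟩
    linear_combination hw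
  · obtain ⟨t, ht⟩ := (hπ.dvd_or_dvd h₁₂).resolve_left hf₂
    obtain rfl : c₁ = c₂ * f₂ + π * t := by linear_combination ht
    have hc₂ : π ∣ c₂ := by
      refine cancel _ _ hlin ⟨w - algebraMap A B d₀ - algebraMap A B t * x, ?_⟩
      simp only [map_add, map_mul] at hw
      linear_combination hw
    exact ⟨dvd_add (hc₂.mul_right _) (dvd_mul_right _ _), hc₂⟩

end Maximality

theorem exists_combination_of_mem_adjoin {A B : Type*} [CommRing A] [IsDomain A] [CommRing B]
    [Algebra A B] {x : B} {f₀ f₁ f₂ : A}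
    (hx : x ^ 3 + algebraMap A B f₂ * x ^ 2 + algebraMap A B f₁ * x + algebraMap A B f₀ = 0) {y : B} (hy : y ∈ Algebra.adjoin A {x}) :
    ∃ c₀ c₁ c₂ : A, y = algebraMap A B c₀ + algebraMap A B c₁ * x + algebraMap A B c₂ * x ^ 2 := by
  rw [Algebra.adjoin_singleton_eq_range_aeval] at hy
  obtain ⟨g, rfl⟩ := hy
  set f : A[X] := X ^ 3 + C f₂ * X ^ 2 + C f₁ * X + C f₀ with hf
  have hfm : f.Monic := by rw [hf]; monicity!
  have hfx : aeval x f = 0 := by simpa [hf] using hx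
  have hdeg : (g %ₘ f).natDegree < 3 := by
    have : f.natDegree = 3 := by rw [hf]; compute_degree!
    have h1 : f ≠ 1 := fun h => by simp [h] at this
    exact this ▸ natDegree_modByMonic_lt g hfm h1
  refine ⟨(g %ₘ f).coeff 0, (g %ₘ f).coeff 1, (g %ₘ f).coeff 2, ?_⟩
  have : aeval x g = aeval x (g %ₘ f) := by
    conv_lhs => rw [← modByMonic_add_div g f]
    simp [hfx]
  simp only [AlgHom.toRingHom_eq_coe, RingHom.coe_coe]
  rw [this, aeval_eq_sum_range' hdeg]
  simp [Finset.sum_range_succ, Algebra.smul_def]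

theorem map_cubic {A : Type*} (K L : Type*) {B : Type*} [CommRing A]
    [Field K] [Algebra A K] [Field L] [Algebra K L] [Algebra A L] [IsScalarTower A K L]
    [CommRing B] [Algebra A B] [Algebra B L] [IsScalarTower A B L] {x : B} {f₀ f₁ f₂ : A}
    (hx : x ^ 3 + algebraMap A B f₂ * x ^ 2 + algebraMap A B f₁ * x + algebraMap A B f₀ = 0) :
    algebraMap B L x ^ 3 + algebraMap K L (algebraMap A K f₂) * algebraMap B L x ^ 2
    + algebraMap K L (algebraMap A K f₁) * algebraMap B L x
    + algebraMap K L (algebraMap A K f₀) = 0 := by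
  have := congrArg (algebraMap B L) hx
  simpa only [map_add, map_mul, map_pow, map_zero, ← IsScalarTower.algebraMap_apply] using this

/-! ### Conductor, different and discriminant of an integral cubic generator -/

section Different

variable {A : Type*} (K L : Type*) {B : Type*} [CommRing A] [IsDomain A] [IsPrincipalIdealRing A]
  [Field K] [Algebra A K] [IsFractionRing A K] [Field L] [Algebra K L] [Algebra A L]
  [IsScalarTower A K L] [FiniteDimensional K L] [Algebra.IsSeparable K L]
  [CommRing B] [Algebra A B] [Algebra B L] [IsScalarTower A B L]
  [IsIntegralClosure B A L] [IsDedekindDomain B] [Module.Finite A B] [Module.IsTorsionFree A B]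

include K L in
theorem intNorm_algebraMap_cubic (h3 : Module.finrank K L = 3) (c : A) :
    Algebra.intNorm A B (algebraMap A B c) = c ^ 3 := by
  have : FaithfulSMul A K := inferInstance
  apply IsFractionRing.injective A K
  rw [Algebra.algebraMap_intNorm (K := K) (L := L), ← IsScalarTower.algebraMap_apply,
    IsScalarTower.algebraMap_apply A K L, Algebra.norm_algebraMap, h3, map_pow]

variable {x : B} {f₀ f₁ f₂ : A}
  (hx : x ^ 3 + algebraMap A B f₂ * x ^ 2 + algebraMap A B f₁ * x + algebraMap A B f₀ = 0)

variable (h3 : Module.finrank K L = 3) (hxK : algebraMap B L x ∉ Set.range (algebraMap K L))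

include hx h3 hxK

omit [FiniteDimensional K L] [Algebra.IsSeparable K L] [Module.Finite A B]
  [Module.IsTorsionFree A B] in
theorem minpoly_eq_cubic_int : minpoly A x = X ^ 3 + C f₂ * X ^ 2 + C f₁ * X + C f₀ := by
  have h1 := minpoly_eq_cubic h3 hxK (map_cubic K L hx)
  rw [minpoly.isIntegrallyClosed_eq_field_fractions K L (IsIntegralClosure.isIntegral A L x)] at h1
  apply Polynomial.map_injective _ (IsFractionRing.injective A K)
  rw [h1]
  simp

omit [Algebra.IsSeparable K L] in
theorem intNorm_gen_cubic : Algebra.intNorm A B x = -f₀ := by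
  apply IsFractionRing.injective A K
  rw [Algebra.algebraMap_intNorm (K := K) (L := L), norm_gen_cubic h3 hxK (map_cubic K L hx), map_neg]

omit [Algebra.IsSeparable K L] in
theorem intNorm_derivative_cubic :
    Algebra.intNorm A B (aeval x (derivative (minpoly A x))) = -disc3 f₂ f₁ f₀ := by
  apply IsFractionRing.injective A K
  have e : algebraMap B L (aeval x (derivative (minpoly A x))) = 3 * algebraMap B L x ^ 2
      + 2 * algebraMap K L (algebraMap A K f₂) * algebraMap B L x
      + algebraMap K L (algebraMap A K f₁) := by
    rw [minpoly_eq_cubic_int K L hx h3 hxK]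
    simp [← IsScalarTower.algebraMap_apply, map_ofNat]
    ring
  rw [Algebra.algebraMap_intNorm (K := K) (L := L), e,
    norm_derivative_cubic h3 hxK (map_cubic K L hx)]
  simp [disc3, map_ofNat]

omit [IsDomain A] [IsPrincipalIdealRing A] [IsFractionRing A K] [FiniteDimensional K L]
  [IsIntegralClosure B A L] [IsDedekindDomain B] [Module.Finite A B] [Module.IsTorsionFree A B] in
theorem disc3_ne_zero : disc3 f₂ f₁ f₀ ≠ 0 := by
  have h := disc3_ne_zero_of_isSeparable h3 hxK (map_cubic K L hx)
  intro h0
  apply h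
  have := congrArg (algebraMap A K) h0
  simpa [disc3, map_ofNat] using this

/-- Conductor times different is generated by f′(x), whose norm is the discriminant up to sign. -/
theorem relNorm_conductor_mul_relNorm_differentIdeal :
    Ideal.relNorm A (conductor A x) * Ideal.relNorm A (differentIdeal A B)
      = Ideal.span {disc3 f₂ f₁ f₀} := by
  rw [← map_mul, conductor_mul_differentIdeal A K L x (algebra_adjoin_eq_top h3 hxK),
    Ideal.relNorm_singleton, intNorm_derivative_cubic K L hx h3 hxK, Ideal.span_singleton_neg]

/-- f′(x) lies in the conductor, and it divides its own norm. -/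
theorem algebraMap_disc3_mem_conductor : algebraMap A B (disc3 f₂ f₁ f₀) ∈ conductor A x := by
  have h : aeval x (derivative (minpoly A x)) ∈ conductor A x := by
    have := Ideal.mem_span_singleton_self (aeval x (derivative (minpoly A x)))
    rw [← conductor_mul_differentIdeal A K L x (algebra_adjoin_eq_top h3 hxK)] at this
    exact Ideal.mul_le_left this
  have h2 : algebraMap A B (Algebra.intNorm A B (aeval x (derivative (minpoly A x))))
      ∈ conductor A x := Ideal.mem_of_dvd _ (Algebra.dvd_algebraMap_intNorm_self A B _) h
  rw [intNorm_derivative_cubic K L hx h3 hxK, map_neg] at h2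
  exact neg_mem_iff.1 h2

end Different

end

section

/-! ### The order of the discriminant ideal at one place -/

section LocalDiscriminant

variable {A : Type*} (K L : Type*) {B : Type*} [CommRing A] [IsDomain A] [IsPrincipalIdealRing A]
  [Field K] [Algebra A K] [IsFractionRing A K] [Field L] [Algebra K L] [Algebra A L]
  [IsScalarTower A K L] [FiniteDimensional K L] [Algebra.IsSeparable K L]
  [CommRing B] [Algebra A B] [Algebra B L] [IsScalarTower A B L]
  [IsIntegralClosure B A L] [IsDedekindDomain B] [Module.Finite A B] [Module.IsTorsionFree A B]

/-- If `x` is a root of `X³ + f₂X² + πf₁X + πf₀` with `π ∤ f₀`, then the conductor of `A[x]` is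
prime to `π`. -/
theorem exists_mem_conductor_not_dvd (h3 : Module.finrank K L = 3) {π f₀ f₁ f₂ : A} {x : B}
    (hπ : Prime π) (hf₀ : ¬ π ∣ f₀)
    (hx : x ^ 3 + algebraMap A B f₂ * x ^ 2 + algebraMap A B (π * f₁) * x
      + algebraMap A B (π * f₀) = 0)
    (hxK : algebraMap B L x ∉ Set.range (algebraMap K L)) :
    ∃ m : A, ¬ π ∣ m ∧ algebraMap A B m ∈ conductor A x := by
  have hπB : algebraMap A B π ≠ 0 := by
    rw [Ne, FaithfulSMul.algebraMap_eq_zero_iff]; exact hπ.ne_zero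
  have step : ∀ y : B, algebraMap A B π * y ∈ Algebra.adjoin A {x} → y ∈ Algebra.adjoin A {x} := by
    intro y hy
    obtain ⟨c₀, c₁, c₂, hc⟩ := exists_combination_of_mem_adjoin hx hy
    obtain ⟨⟨d₀, rfl⟩, ⟨d₁, rfl⟩, ⟨d₂, rfl⟩⟩ := dvd_coeffs_of_dvd_combination hπ hf₀ hx
      (Algebra.intNorm A B) (intNorm_algebraMap_cubic K L h3) (intNorm_gen_cubic K L hx h3 hxK)
      ⟨y, hc.symm⟩
    have : y = algebraMap A B d₀ + algebraMap A B d₁ * x + algebraMap A B d₂ * x ^ 2 := by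
      apply mul_left_cancel₀ hπB
      rw [hc]
      simp only [map_mul]
      ring
    rw [this]
    have hxm : x ∈ Algebra.adjoin A {x} := Algebra.self_mem_adjoin_singleton A x
    exact add_mem (add_mem (algebraMap_mem _ _) (mul_mem (algebraMap_mem _ _) hxm))
      (mul_mem (algebraMap_mem _ _) (pow_mem hxm 2))
  -- The discriminant lies in the conductor; its factors π are stripped off one at a time by `step`,
  -- leaving a cofactor prime to π.
  obtain ⟨m, hD, hm⟩ := (FiniteMultiplicity.of_prime_left hπ
    (disc3_ne_zero K L hx h3 hxK)).exists_eq_pow_mul_and_not_dvd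
  refine ⟨m, hm, ?_⟩
  have hmem := algebraMap_disc3_mem_conductor K L hx h3 hxK
  rw [hD] at hmem
  generalize multiplicity π (disc3 f₂ (π * f₁) (π * f₀)) = n at hmem
  clear hD
  induction n with
  | zero => simpa using hmem
  | succ n ih =>
    refine ih (mem_conductor_iff.2 fun y => step _ ?_)
    have := mem_conductor_iff.1 hmem y
    rwa [pow_succ', mul_assoc, map_mul, mul_assoc] at this

omit [Module.Finite A B] in
/-- The discriminant of a basis of integral elements lies in the different. -/
theorem discr_mem_differentIdeal {ι : Type*} [Fintype ι] [DecidableEq ι]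
    (b : Module.Basis ι K L) (hb : ∀ i, IsIntegral A (b i)) {D : A}
    (hD : algebraMap A K D = Algebra.discr K b) :
    algebraMap A B D ∈ differentIdeal A B := by
  have := IsIntegralClosure.isFractionRing_of_finite_extension A K L B
  suffices h : algebraMap B L (algebraMap A B D) ∈ IsLocalization.coeSubmodule L
      (differentIdeal A B) by
    obtain ⟨z, hz, hzD⟩ := h
    rwa [← IsFractionRing.injective B L hzD]
  rw [coeSubmodule_differentIdeal A K, Submodule.mem_div_iff_forall_mul_mem]
  intro y hy
  -- The different is the inverse of the trace dual, and the discriminant of an integral basis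
  -- multiplies the trace dual into the integral elements.
  have hi := isIntegral_discr_mul_of_mem_traceDual (A := A) (K := K) (1 : Submodule B L) hb
    (a := 1) (Submodule.one_le.1 le_rfl) hy
  rw [← hD, smul_mul_assoc, one_mul, Algebra.smul_def] at hi
  obtain ⟨z, hz⟩ := (IsIntegralClosure.isIntegral_iff (A := B)).1 hi
  refine Submodule.mem_one.2 ⟨z, ?_⟩
  rw [hz, ← IsScalarTower.algebraMap_apply, ← IsScalarTower.algebraMap_apply]

variable (v : HeightOneSpectrum A)

theorem count_span_singleton {a : A} (ha : a ≠ 0) :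
    FractionalIdeal.count K v ((Ideal.span {a} : Ideal A) : FractionalIdeal A⁰ K)
      = -WithZero.log (v.valuation K (algebraMap A K a)) := by
  classical
  rw [FractionalIdeal.count_coe K v (by simpa using ha), HeightOneSpectrum.valuation_of_algebraMap,
    HeightOneSpectrum.intValuation_if_neg v ha, WithZero.log_exp, neg_neg]

theorem count_coeIdeal_eq_zero {I : Ideal A} {a : A} (haI : a ∈ I)
    (hav : a ∉ v.asIdeal) : FractionalIdeal.count K v (I : FractionalIdeal A⁰ K) = 0 := by
  have ha : a ≠ 0 := fun h => hav (h ▸ zero_mem _)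
  refine le_antisymm ?_ (FractionalIdeal.count_coe_nonneg K v I)
  have h1 : FractionalIdeal.count K v ((Ideal.span {a} : Ideal A) : FractionalIdeal A⁰ K) = 0 := by
    rw [count_span_singleton K v ha, (HeightOneSpectrum.valuation_eq_one_iff_notMem v).2 hav, WithZero.log_one,
      neg_zero]
  rw [← h1]
  refine FractionalIdeal.count_mono K v ?_ ?_
  · rw [FractionalIdeal.coeIdeal_ne_zero, Ne, Ideal.span_singleton_eq_bot]; exact ha
  · exact (FractionalIdeal.coeIdeal_le_coeIdeal K).2 ((Ideal.span_singleton_le_iff_mem I).2 haI)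

-- The norm of the scalar m is m³, still prime to v.
include L in
theorem count_relNorm_eq_zero (h3 : Module.finrank K L = 3) {I : Ideal B} {m : A}
    (hm : m ∉ v.asIdeal) (hmI : algebraMap A B m ∈ I) :
    FractionalIdeal.count K v (Ideal.relNorm A I : FractionalIdeal A⁰ K) = 0 := by
  refine count_coeIdeal_eq_zero K v (a := m ^ 3) ?_ fun h => hm (v.isPrime.mem_of_pow_mem _ h)
  rw [Ideal.relNorm_apply, ← intNorm_algebraMap_cubic (B := B) K L h3]
  exact Ideal.subset_span ⟨_, hmI, rfl⟩

theorem count_relNorm_differentIdeal_eq_zero (h3 : Module.finrank K L = 3)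
    {ι : Type*} [Fintype ι] [DecidableEq ι]
    (b : Module.Basis ι K L) (hb : ∀ i, IsIntegral A (b i)) {D : A}
    (hD : algebraMap A K D = Algebra.discr K b) (hDv : D ∉ v.asIdeal) :
    FractionalIdeal.count K v (Ideal.relNorm A (differentIdeal A B) : FractionalIdeal A⁰ K) = 0 :=
  count_relNorm_eq_zero K L v h3 hDv (discr_mem_differentIdeal K L b hb hD)

/-- The conductor contains a scalar prime to v, so at v the whole discriminant comes from the
different. -/
theorem count_relNorm_differentIdeal_eq (h3 : Module.finrank K L = 3) {π f₀ f₁ f₂ : A} {x : B}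
    (hπ : v.asIdeal = Ideal.span {π}) (hf₀ : f₀ ∉ v.asIdeal)
    (hx : x ^ 3 + algebraMap A B f₂ * x ^ 2 + algebraMap A B (π * f₁) * x
      + algebraMap A B (π * f₀) = 0)
    (hxK : algebraMap B L x ∉ Set.range (algebraMap K L)) :
    FractionalIdeal.count K v (Ideal.relNorm A (differentIdeal A B) : FractionalIdeal A⁰ K)
      = -WithZero.log (v.valuation K (algebraMap A K (disc3 f₂ (π * f₁) (π * f₀)))) := by
  have hπ0 : π ≠ 0 := fun h => v.ne_bot (by simp [hπ, h])
  have hπp : Prime π := by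
    rw [← Ideal.span_singleton_prime hπ0, ← hπ]; exact v.isPrime
  rw [hπ, Ideal.mem_span_singleton] at hf₀
  obtain ⟨m, hm, hmc⟩ := exists_mem_conductor_not_dvd K L h3 hπp hf₀ hx hxK
  rw [← Ideal.mem_span_singleton, ← hπ] at hm
  have hD := disc3_ne_zero K L hx h3 hxK
  have hrel := relNorm_conductor_mul_relNorm_differentIdeal K L hx h3 hxK
  rw [← count_span_singleton K v hD, ← hrel, FractionalIdeal.coeIdeal_mul]
  have hne : Ideal.relNorm A (conductor A x) * Ideal.relNorm A (differentIdeal A B) ≠ ⊥ := by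
    rw [hrel, Ne, Ideal.span_singleton_eq_bot]; exact hD
  rw [FractionalIdeal.count_mul, count_relNorm_eq_zero K L v h3 hm hmc, zero_add]
  · exact FractionalIdeal.coeIdeal_ne_zero.2 (left_ne_zero_of_mul hne)
  · exact FractionalIdeal.coeIdeal_ne_zero.2 (right_ne_zero_of_mul hne)

end LocalDiscriminant

end

section

/-! ### The two local criteria, with coefficients in the field -/

section LocalCriteria

variable {A : Type*} (K L : Type*) (B : Type*) [CommRing A] [IsDomain A] [IsPrincipalIdealRing A]
  [Field K] [Algebra A K] [IsFractionRing A K] [Field L] [Algebra K L] [Algebra A L]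
  [IsScalarTower A K L] [FiniteDimensional K L] [Algebra.IsSeparable K L]
  [CommRing B] [Algebra A B] [Algebra B L] [IsScalarTower A B L]
  [IsIntegralClosure B A L] [IsDedekindDomain B] [Module.Finite A B] [Module.IsTorsionFree A B]
  (v : HeightOneSpectrum A)

variable {K} in
theorem exists_mul_eq_of_valuation_le_one {x : K} (hx : v.valuation K x ≤ 1) :
    ∃ m ∉ v.asIdeal, ∃ n : A, algebraMap A K m * x = algebraMap A K n := by
  obtain ⟨n, ⟨d, hd⟩, h⟩ := v.exists_primeCompl_mul_eq_of_integer x hx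
  exact ⟨d, hd, n, by rw [mul_comm]; exact h⟩

omit [FiniteDimensional K L] [Algebra.IsSeparable K L] in
variable {K L} in
/-- A root of a monic cubic with coefficients integral at `v` becomes integral after
multiplication by an element prime to `v`. -/
theorem exists_isIntegral_mul_of_cubic {θ : L} {t₀ t₁ t₂ : K}
    (h : θ ^ 3 + algebraMap K L t₂ * θ ^ 2 + algebraMap K L t₁ * θ + algebraMap K L t₀ = 0)
    (h₂ : v.valuation K t₂ ≤ 1) (h₁ : v.valuation K t₁ ≤ 1) (h₀ : v.valuation K t₀ ≤ 1) :
    ∃ m ∉ v.asIdeal, IsIntegral A (algebraMap A L m * θ) := by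
  obtain ⟨m₂, hm₂, n₂, e₂⟩ := exists_mul_eq_of_valuation_le_one v h₂
  obtain ⟨m₁, hm₁, n₁, e₁⟩ := exists_mul_eq_of_valuation_le_one v h₁
  obtain ⟨m₀, hm₀, n₀, e₀⟩ := exists_mul_eq_of_valuation_le_one v h₀
  have hmul : ∀ {a b}, a ∉ v.asIdeal → b ∉ v.asIdeal → a * b ∉ v.asIdeal := fun ha hb h =>
    (v.isPrime.mem_or_mem h).elim ha hb
  -- For m = m₀m₁m₂ the coefficients of the cubic of mθ are mt₂, m²t₁, m³t₀, and each contains the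
  -- factor that clears its denominator.
  refine ⟨m₀ * m₁ * m₂, hmul (hmul hm₀ hm₁) hm₂, X ^ 3 + C (m₀ * m₁ * n₂) * X ^ 2
    + C (m₀ ^ 2 * m₁ * m₂ ^ 2 * n₁) * X + C (m₀ ^ 2 * m₁ ^ 3 * m₂ ^ 3 * n₀), by monicity!, ?_⟩
  have e₂' := congrArg (algebraMap K L) e₂
  have e₁' := congrArg (algebraMap K L) e₁
  have e₀' := congrArg (algebraMap K L) e₀
  simp only [map_mul, ← IsScalarTower.algebraMap_apply] at e₂' e₁' e₀'
  simp only [eval₂_add, eval₂_mul, eval₂_pow, eval₂_X, eval₂_C, map_mul, map_pow, ← e₂', ← e₁',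
    ← e₀']
  linear_combination (algebraMap A L m₀ * algebraMap A L m₁ * algebraMap A L m₂) ^ 3 * h

/-- A scalar m prime to v clears the denominators: mθ satisfies a cubic of the same shape over `A`,
and the discriminant only changes by m⁶. -/
theorem count_differentIdeal_of_eisenstein_or_partial (h3 : Module.finrank K L = 3) {π : A}
    {θ : L} {t₀ t₁ t₂ : K} (hπ : v.asIdeal = Ideal.span {π})
    (h : θ ^ 3 + algebraMap K L t₂ * θ ^ 2 + algebraMap K L (algebraMap A K π * t₁) * θ
      + algebraMap K L (algebraMap A K π * t₀) = 0)
    (hθ : θ ∉ Set.range (algebraMap K L))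
    (h₂ : v.valuation K t₂ ≤ 1) (h₁ : v.valuation K t₁ ≤ 1) (h₀ : v.valuation K t₀ = 1) :
    FractionalIdeal.count K v (Ideal.relNorm A (differentIdeal A B) : FractionalIdeal A⁰ K)
      = -WithZero.log (v.valuation K
          (disc3 t₂ (algebraMap A K π * t₁) (algebraMap A K π * t₀))) := by
  obtain ⟨m₂, hm₂, n₂, e₂⟩ := exists_mul_eq_of_valuation_le_one v h₂
  obtain ⟨m₁, hm₁, n₁, e₁⟩ := exists_mul_eq_of_valuation_le_one v h₁
  obtain ⟨m₀, hm₀, n₀, e₀⟩ := exists_mul_eq_of_valuation_le_one v h₀.le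
  have hmul : ∀ {a b}, a ∉ v.asIdeal → b ∉ v.asIdeal → a * b ∉ v.asIdeal := fun ha hb h =>
    (v.isPrime.mem_or_mem h).elim ha hb
  have hval : ∀ {a}, a ∉ v.asIdeal → v.valuation K (algebraMap A K a) = 1 := fun ha =>
    (HeightOneSpectrum.valuation_eq_one_iff_notMem v).2 ha
  set m := m₀ * m₁ * m₂ with hmdef
  have hm : m ∉ v.asIdeal := hmul (hmul hm₀ hm₁) hm₂
  have hm0 : algebraMap A K m ≠ 0 := fun h => by
    have := hval hm
    rw [h, map_zero] at this
    exact zero_ne_one this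
  set g₂ : A := m₀ * m₁ * n₂
  set g₁ : A := m₀ ^ 2 * m₁ * m₂ ^ 2 * n₁
  set g₀ : A := m₀ ^ 2 * m₁ ^ 3 * m₂ ^ 3 * n₀
  have k₂ : algebraMap A K g₂ = algebraMap A K m * t₂ := by
    simp only [g₂, m, map_mul, ← e₂]; ring
  have k₁ : algebraMap A K g₁ = algebraMap A K m ^ 2 * t₁ := by
    simp only [g₁, m, map_mul, map_pow, ← e₁]; ring
  have k₀ : algebraMap A K g₀ = algebraMap A K m ^ 3 * t₀ := by
    simp only [g₀, m, map_mul, map_pow, ← e₀]; ring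
  have l₂ := congrArg (algebraMap K L) k₂
  have l₁ := congrArg (algebraMap K L) k₁
  have l₀ := congrArg (algebraMap K L) k₀
  simp only [map_mul, map_pow, ← IsScalarTower.algebraMap_apply] at l₂ l₁ l₀ h
  have hx : (algebraMap A L m * θ) ^ 3 + algebraMap A L g₂ * (algebraMap A L m * θ) ^ 2
      + algebraMap A L (π * g₁) * (algebraMap A L m * θ) + algebraMap A L (π * g₀) = 0 := by
    rw [map_mul _ π g₁, map_mul _ π g₀, l₂, l₁, l₀]
    linear_combination algebraMap A L m ^ 3 * h
  have hint : IsIntegral A (algebraMap A L m * θ) :=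
    ⟨X ^ 3 + C g₂ * X ^ 2 + C (π * g₁) * X + C (π * g₀), by monicity!, by
      simpa only [eval₂_add, eval₂_mul, eval₂_pow, eval₂_X, eval₂_C] using hx⟩
  obtain ⟨x, hxθ⟩ := (IsIntegralClosure.isIntegral_iff (A := B)).1 hint
  have hx' : x ^ 3 + algebraMap A B g₂ * x ^ 2 + algebraMap A B (π * g₁) * x
      + algebraMap A B (π * g₀) = 0 := by
    apply IsIntegralClosure.algebraMap_injective B A L
    simpa only [map_add, map_mul, map_pow, map_zero, ← IsScalarTower.algebraMap_apply, hxθ]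
      using hx
  have hxK : algebraMap B L x ∉ Set.range (algebraMap K L) := by
    rintro ⟨c, hc⟩
    refine hθ ⟨c / algebraMap A K m, ?_⟩
    rw [map_div₀, hc, hxθ, ← IsScalarTower.algebraMap_apply, mul_div_cancel_left₀]
    rw [IsScalarTower.algebraMap_apply A K L]
    simpa using hm0
  have hg₀ : g₀ ∉ v.asIdeal := by
    rw [← HeightOneSpectrum.valuation_eq_one_iff_notMem (K := K) v, k₀, map_mul, map_pow, hval hm,
      h₀, one_pow, one_mul]
  rw [count_relNorm_differentIdeal_eq K L v h3 hπ hg₀ hx' hxK]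
  have : algebraMap A K (disc3 g₂ (π * g₁) (π * g₀)) = algebraMap A K m ^ 6
      * disc3 t₂ (algebraMap A K π * t₁) (algebraMap A K π * t₀) := by
    simp only [disc3, map_add, map_sub, map_mul, map_pow, map_ofNat, k₂, k₁, k₀]
    ring
  rw [this, map_mul, map_pow, hval hm, one_pow, one_mul]

/-- For suitable m, n prime to v, the elements 1, mθ, nW are integral. Their matrix over 1, θ, θ² is
triangular with determinant mnr, so their discriminant is a unit at v. -/
theorem count_differentIdeal_eq_zero (h3 : Module.finrank K L = 3)
    {θ : L} {t₀ t₁ t₂ p q r s₀ s₁ s₂ : K}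
    (h : θ ^ 3 + algebraMap K L t₂ * θ ^ 2 + algebraMap K L t₁ * θ + algebraMap K L t₀ = 0)
    (hθ : θ ∉ Set.range (algebraMap K L))
    (h₂ : v.valuation K t₂ ≤ 1) (h₁ : v.valuation K t₁ ≤ 1) (h₀ : v.valuation K t₀ ≤ 1)
    {W : L} (hW : W = algebraMap K L p + algebraMap K L q * θ + algebraMap K L r * θ ^ 2)
    (hs : W ^ 3 + algebraMap K L s₂ * W ^ 2 + algebraMap K L s₁ * W + algebraMap K L s₀ = 0)
    (hs₂ : v.valuation K s₂ ≤ 1) (hs₁ : v.valuation K s₁ ≤ 1) (hs₀ : v.valuation K s₀ ≤ 1)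
    (hD : v.valuation K (r ^ 2 * disc3 t₂ t₁ t₀) = 1) :
    FractionalIdeal.count K v (Ideal.relNorm A (differentIdeal A B) : FractionalIdeal A⁰ K)
      = 0 := by
  have hval : ∀ {a}, a ∉ v.asIdeal → v.valuation K (algebraMap A K a) = 1 := fun ha =>
    (HeightOneSpectrum.valuation_eq_one_iff_notMem v).2 ha
  obtain ⟨m, hm, hmθ⟩ := exists_isIntegral_mul_of_cubic v h h₂ h₁ h₀
  obtain ⟨n, hn, hnW⟩ := exists_isIntegral_mul_of_cubic v hs hs₂ hs₁ hs₀
  set M := algebraMap A K m with hM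
  set N := algebraMap A K n with hN
  set b : Fin 3 → L := ![1, algebraMap A L m * θ, algebraMap A L n * W] with hb
  have hdiscr : Algebra.discr K b = (M * N * r) ^ 2 * disc3 t₂ t₁ t₀ := by
    have key := Algebra.discr_of_matrix_vecMul (A := K) (fun i : Fin 3 => θ ^ (i : ℕ))
      !![1, 0, N * p; 0, M, N * q; 0, 0, N * r]
    rw [discr_cubic h3 hθ h] at key
    have hbP : Matrix.vecMul (fun i : Fin 3 => θ ^ (i : ℕ))
        ((!![1, 0, N * p; 0, M, N * q; 0, 0, N * r] : Matrix (Fin 3) (Fin 3) K).map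
          (algebraMap K L)) = b := by
      ext i
      fin_cases i
      · simp [hb, Matrix.vecMul, dotProduct, Fin.sum_univ_three]
      · simp [hb, Matrix.vecMul, dotProduct, Fin.sum_univ_three, hM,
          ← IsScalarTower.algebraMap_apply]
        ring
      · simp [hb, Matrix.vecMul, dotProduct, Fin.sum_univ_three, hN, hW,
          ← IsScalarTower.algebraMap_apply]
        ring
    have hdet : (!![1, 0, N * p; 0, M, N * q; 0, 0, N * r] : Matrix (Fin 3) (Fin 3) K).det
        = M * N * r := by
      rw [Matrix.det_fin_three]
      simp
      ring
    rw [← hdet, ← key, hbP]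
  have hdv : v.valuation K (Algebra.discr K b) = 1 := by
    have : Algebra.discr K b = (M * N) ^ 2 * (r ^ 2 * disc3 t₂ t₁ t₀) := by rw [hdiscr]; ring
    rw [this, map_mul, hD, map_pow, map_mul, hval hm, hval hn]
    simp
  have hli : LinearIndependent K b := by
    by_contra hli
    rw [Algebra.discr_zero_of_not_linearIndependent K hli, map_zero] at hdv
    exact zero_ne_one hdv
  have hbint : ∀ i, IsIntegral A (b i) := by
    intro i
    fin_cases i
    · exact isIntegral_one
    · exact hmθ
    · exact hnW
  obtain ⟨D, hD'⟩ := IsIntegrallyClosed.isIntegral_iff.1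
    (Algebra.discr_isIntegral K (R := A) hbint)
  refine count_relNorm_differentIdeal_eq_zero K L v h3
    (basisOfLinearIndependentOfCardEqFinrank hli (by simp [h3])) (D := D) (by simpa using hbint)
    (by simpa using hD') ?_
  rw [← HeightOneSpectrum.valuation_eq_one_iff_notMem (K := K) v, hD', hdv]

end LocalCriteria

end

section

section Combination

variable {K L : Type*} [Field K] [Field L] [Algebra K L]

/-- The coefficients enter through equations, so that each application can prescribe them in a form
that displays its powers of π. -/
theorem cubic_combination {Y : L} {a b c : K}
    (h : Y ^ 3 + algebraMap K L a * Y ^ 2 + algebraMap K L b * Y + algebraMap K L c = 0)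
    {p q r t₀ t₁ t₂ : K} (e₂ : t₂ = -(3 * p - q * a + r * (a ^ 2 - 2 * b)))
    (e₁ : t₁ = 3 * p ^ 2 + 2 * p * (-q * a + r * (a ^ 2 - 2 * b)) + q ^ 2 * b
      + q * r * (3 * c - a * b) + r ^ 2 * (b ^ 2 - 2 * a * c))
    (e₀ : t₀ = -(p ^ 3 - p ^ 2 * q * a + p ^ 2 * r * (a ^ 2 - 2 * b) + p * q ^ 2 * b
      + p * q * r * (3 * c - a * b) + p * r ^ 2 * (b ^ 2 - 2 * a * c) - q ^ 3 * c
      + q ^ 2 * r * (a * c) - q * r ^ 2 * (b * c) + r ^ 3 * c ^ 2)) :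
    (algebraMap K L p + algebraMap K L q * Y + algebraMap K L r * Y ^ 2) ^ 3
      + algebraMap K L t₂ * (algebraMap K L p + algebraMap K L q * Y + algebraMap K L r * Y ^ 2) ^ 2
      + algebraMap K L t₁ * (algebraMap K L p + algebraMap K L q * Y + algebraMap K L r * Y ^ 2)
      + algebraMap K L t₀ = 0 := by
  rw [← cubic_of_quadratic_combination (p := algebraMap K L p) (q := algebraMap K L q)
    (r := algebraMap K L r) h, e₂, e₁, e₀]
  simp only [map_neg, map_add, map_sub, map_mul, map_pow, map_ofNat]

theorem combination_notMem_range (h3 : Module.finrank K L = 3) {Y : L}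
    (hY : Y ∉ Set.range (algebraMap K L)) {p q r : K} (hqr : q ≠ 0 ∨ r ≠ 0) :
    algebraMap K L p + algebraMap K L q * Y + algebraMap K L r * Y ^ 2
      ∉ Set.range (algebraMap K L) := by
  rintro ⟨c, hc⟩
  have : FiniteDimensional K L := Module.finite_of_finrank_pos (by omega)
  set f : K[X] := C r * X ^ 2 + C q * X + C (p - c) with hf
  have hf0 : f ≠ 0 := by
    intro h0
    rcases hqr with h | h
    · apply h
      have := congrArg (fun g => g.coeff 1) h0
      simpa [hf, coeff_X, coeff_C] using this
    · apply h
      have := congrArg (fun g => g.coeff 2) h0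
      simpa [hf, coeff_X, coeff_C] using this
  have hfY : aeval Y f = 0 := by
    simp [hf]
    linear_combination -hc
  have h1 := natDegree_le_of_dvd (minpoly.dvd K Y hfY) hf0
  rw [natDegree_minpoly_eq_three h3 hY] at h1
  have h2 : f.natDegree ≤ 2 := by rw [hf]; compute_degree
  omega

end Combination

/-! ### Tame places: Eisenstein cubics, and the double roots at a = ±2 -/

section LocalComputations

variable {A : Type*} (K L : Type*) (B : Type*) [CommRing A] [IsDomain A] [IsPrincipalIdealRing A]
  [Field K] [Algebra A K] [IsFractionRing A K] [Field L] [Algebra K L] [Algebra A L]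
  [IsScalarTower A K L] [FiniteDimensional K L] [Algebra.IsSeparable K L]
  [CommRing B] [Algebra A B] [Algebra B L] [IsScalarTower A B L]
  [IsIntegralClosure B A L] [IsDedekindDomain B] [Module.Finite A B] [Module.IsTorsionFree A B]
  (v : HeightOneSpectrum A)

theorem valuation_generator {π : A} (hπ : v.asIdeal = Ideal.span {π}) :
    v.valuation K (algebraMap A K π) = WithZero.exp (-1 : ℤ) := by
  have hπ0 : π ≠ 0 := fun h => v.ne_bot (by simp [hπ, h])
  rw [HeightOneSpectrum.valuation_of_algebraMap, v.intValuation_singleton hπ0 hπ]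

theorem valuation_generator_lt_one {π : A} (hπ : v.asIdeal = Ideal.span {π}) :
    v.valuation K (algebraMap A K π) < 1 := by
  rw [valuation_generator K v hπ, ← WithZero.exp_zero, WithZero.exp_lt_exp]
  norm_num

variable {K} in
theorem neg_log_valuation_pow_mul {π : A} (hπ : v.asIdeal = Ideal.span {π}) (n : ℕ) {u : K}
    (hu : v.valuation K u = 1) :
    -WithZero.log (v.valuation K (algebraMap A K π ^ n * u)) = n := by
  rw [map_mul, hu, mul_one, map_pow, valuation_generator K v hπ, WithZero.log_pow,
    WithZero.log_exp]
  simp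

variable {K} in
theorem valuation_add_mul_eq_one {π : A} (hπ : v.asIdeal = Ideal.span {π}) {x y : K}
    (hx : v.valuation K x = 1) (hy : y ∈ (v.valuation K).valuationSubring) :
    v.valuation K (x + algebraMap A K π * y) = 1 := by
  rw [Valuation.map_add_eq_of_lt_left, hx]
  rw [hx, map_mul]
  exact mul_lt_one_of_lt_of_le (valuation_generator_lt_one K v hπ)
    ((Valuation.mem_valuationSubring_iff _ _).1 hy)

theorem algebraMap_mem_valuationSubring (x : A) :
    algebraMap A K x ∈ (v.valuation K).valuationSubring :=
  (Valuation.mem_valuationSubring_iff _ _).2 (v.valuation_le_one x)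

/-- Tame total ramification: an Eisenstein cubic away from characteristic three contributes two to
the discriminant. -/
theorem count_differentIdeal_eq_two (h3 : Module.finrank K L = 3) {π : A}
    {θ : L} {t₀ t₁ t₂ : K} (hπ : v.asIdeal = Ideal.span {π})
    (h : θ ^ 3 + algebraMap K L (algebraMap A K π * t₂) * θ ^ 2
      + algebraMap K L (algebraMap A K π * t₁) * θ + algebraMap K L (algebraMap A K π * t₀) = 0)
    (hθ : θ ∉ Set.range (algebraMap K L)) (hv3 : v.valuation K 3 = 1)
    (h₂ : t₂ ∈ (v.valuation K).valuationSubring) (h₁ : t₁ ∈ (v.valuation K).valuationSubring)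
    (h₀ : v.valuation K t₀ = 1) :
    FractionalIdeal.count K v (Ideal.relNorm A (differentIdeal A B) : FractionalIdeal A⁰ K)
      = 2 := by
  have hp := algebraMap_mem_valuationSubring K v π
  have h₀' : t₀ ∈ (v.valuation K).valuationSubring := h₀.le
  rw [count_differentIdeal_of_eisenstein_or_partial K L B v h3 hπ h hθ (mul_mem hp h₂) h₁ h₀]
  -- Once π² is taken out, the discriminant is −27t₀² modulo π.
  have hu : v.valuation K (-(3 ^ 3 * t₀ ^ 2) + algebraMap A K π
      * (algebraMap A K π * t₂ ^ 2 * t₁ ^ 2 - 4 * t₁ ^ 3 - 4 * algebraMap A K π * t₂ ^ 3 * t₀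
        + 18 * t₂ * t₁ * t₀)) = 1 := by
    refine valuation_add_mul_eq_one v hπ ?_ ?_
    · rw [Valuation.map_neg, map_mul, map_pow, map_pow, hv3, h₀, one_pow, one_pow, one_mul]
    · apply_rules [add_mem, sub_mem, mul_mem, pow_mem, ofNat_mem]
  have e : disc3 (algebraMap A K π * t₂) (algebraMap A K π * t₁) (algebraMap A K π * t₀)
      = algebraMap A K π ^ 2 * (-(3 ^ 3 * t₀ ^ 2) + algebraMap A K π
      * (algebraMap A K π * t₂ ^ 2 * t₁ ^ 2 - 4 * t₁ ^ 3 - 4 * algebraMap A K π * t₂ ^ 3 * t₀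
        + 18 * t₂ * t₁ * t₀)) := by
    rw [disc3]; ring
  rw [e, neg_log_valuation_pow_mul v hπ 2 hu]
  rfl

/-- Simple tame ramification. -/
theorem count_differentIdeal_eq_one (h3 : Module.finrank K L = 3) {π : A}
    {y : L} {a c ε : K} (hπ : v.asIdeal = Ideal.span {π})
    (hy : y ^ 3 - 3 * y - algebraMap K L a = 0) (hyK : y ∉ Set.range (algebraMap K L))
    (hv2 : v.valuation K 2 = 1) (hv3 : v.valuation K 3 = 1) (hε : ε ^ 2 = 1) (j : ℕ)
    (ha : a = 2 * ε + algebraMap A K π ^ (2 * j + 1) * c) (hc : v.valuation K c = 1) :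
    FractionalIdeal.count K v (Ideal.relNorm A (differentIdeal A B) : FractionalIdeal A⁰ K)
      = 1 := by
  set ϖ := algebraMap A K π with hϖ
  have hp : ϖ ∈ (v.valuation K).valuationSubring := algebraMap_mem_valuationSubring K v π
  have hϖ0 : ϖ ≠ 0 := fun h0 => by
    have := valuation_generator K v hπ
    rw [← hϖ, h0, map_zero] at this
    exact WithZero.exp_ne_zero this.symm
  have hvε : v.valuation K ε = 1 := by
    have := congrArg (v.valuation K) hε
    simpa using this
  have hε' : ε ∈ (v.valuation K).valuationSubring := hvε.le
  have hc' : c ∈ (v.valuation K).valuationSubring := hc.le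
  have h3K : (3 : K) ≠ 0 := fun h0 => by rw [h0, map_zero] at hv3; exact zero_ne_one hv3
  have hε0 : ε ≠ 0 := fun h0 => by rw [h0, map_zero] at hvε; exact zero_ne_one hvε
  set P := ϖ ^ j with hP
  have hP0 : P ≠ 0 := pow_ne_zero _ hϖ0
  have hP' : P ∈ (v.valuation K).valuationSubring := pow_mem hp j
  have ha' : a = 2 * ε + ϖ * P ^ 2 * c := by rw [ha, hP]; ring
  -- The shift Y = y + ε moves the approximate double root to 0: Y²(Y − 3ε) = a − 2ε.
  have hY : (y + algebraMap K L ε) ^ 3 + algebraMap K L (-3 * ε) * (y + algebraMap K L ε) ^ 2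
      + algebraMap K L 0 * (y + algebraMap K L ε) + algebraMap K L (-(ϖ * P ^ 2 * c)) = 0 := by
    have hεL := congrArg (algebraMap K L) hε
    have haL := congrArg (algebraMap K L) ha'
    simp only [map_add, map_mul, map_neg, map_pow, map_one, map_ofNat, map_zero] at hεL haL ⊢
    linear_combination hy + haL + (-3 * y - 2 * algebraMap K L ε) * hεL
  have hYK : y + algebraMap K L ε ∉ Set.range (algebraMap K L) := by
    rintro ⟨z, hz⟩
    exact hyK ⟨z - ε, by rw [map_sub, hz]; ring⟩
  -- The element is Y² + Y(Y − 3ε)/πʲ. The quotient absorbs the even part of the order of a − 2ε;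
  -- adding Y² separates off a root congruent to 9 and makes the constant term of exact order one.
  have hθ := cubic_combination hY (p := 0) (q := -3 * ε * P⁻¹) (r := 1 + P⁻¹) (t₂ := -9)
    (t₁ := ϖ * (3 * ε * c * (P + 1) * (1 - 2 * P)))
    (t₀ := ϖ * (-(3 ^ 3 * ε * c) + ϖ * -(P * (P + 1) ^ 3 * c ^ 2)))
    (by linear_combination (9 : K) * hε)
    (by field_simp; ring)
    (by
      field_simp
      linear_combination (27 * c * ϖ * P ^ 2 * ε) * hε)
  have hq : (-3 * ε * P⁻¹ : K) ≠ 0 :=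
    mul_ne_zero (mul_ne_zero (neg_ne_zero.2 h3K) hε0) (inv_ne_zero hP0)
  set t₁ := 3 * ε * c * (P + 1) * (1 - 2 * P) with ht₁
  set t₀ := -(3 ^ 3 * ε * c) + ϖ * -(P * (P + 1) ^ 3 * c ^ 2) with ht₀
  have h₁ : t₁ ∈ (v.valuation K).valuationSubring := by
    apply_rules [add_mem, sub_mem, mul_mem, pow_mem, ofNat_mem, one_mem]
  have h₀ : v.valuation K t₀ = 1 := by
    refine valuation_add_mul_eq_one v hπ ?_ ?_
    · simp [hv3, hvε, hc]
    · apply_rules [neg_mem, add_mem, sub_mem, mul_mem, pow_mem, ofNat_mem, one_mem]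
  have h₀' : t₀ ∈ (v.valuation K).valuationSubring := h₀.le
  have h9 : (-9 : K) ∈ (v.valuation K).valuationSubring := by
    apply_rules [neg_mem, ofNat_mem]
  rw [count_differentIdeal_of_eisenstein_or_partial K L B v h3 hπ hθ
    (combination_notMem_range h3 hYK (Or.inl hq)) h9 h₁ h₀]
  -- Modulo π² only −4b³d with b = −9 survives, and 4·9³ = 2²·3⁶ is a unit at v.
  have e : disc3 (-9) (ϖ * t₁) (ϖ * t₀) = ϖ ^ 1 * (2 ^ 2 * 3 ^ 6 * t₀
      + ϖ * (81 * t₁ ^ 2 - 4 * ϖ * t₁ ^ 3 - 27 * t₀ ^ 2 - 162 * t₁ * t₀)) := by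
    rw [disc3]; ring
  rw [e, neg_log_valuation_pow_mul v hπ 1, Nat.cast_one]
  refine valuation_add_mul_eq_one v hπ ?_ ?_
  · simp [hv2, hv3, h₀]
  · apply_rules [neg_mem, add_mem, sub_mem, mul_mem, pow_mem, ofNat_mem, one_mem]

/-- Absence of ramification when `a² - 4` has even order. -/
theorem count_differentIdeal_eq_zero_of_even (h3 : Module.finrank K L = 3) {π : A}
    {y : L} {a c ε : K} (hπ : v.asIdeal = Ideal.span {π})
    (hy : y ^ 3 - 3 * y - algebraMap K L a = 0) (hyK : y ∉ Set.range (algebraMap K L))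
    (hv3 : v.valuation K 3 = 1) (hε : ε ^ 2 = 1) (j : ℕ)
    (ha : a = 2 * ε + algebraMap A K π ^ (2 * j) * c) (hc : v.valuation K c = 1)
    (ha2 : v.valuation K (a + 2 * ε) = 1) :
    FractionalIdeal.count K v (Ideal.relNorm A (differentIdeal A B) : FractionalIdeal A⁰ K)
      = 0 := by
  set ϖ := algebraMap A K π with hϖ
  have hp : ϖ ∈ (v.valuation K).valuationSubring := algebraMap_mem_valuationSubring K v π
  have hϖ0 : ϖ ≠ 0 := fun h0 => by
    have := valuation_generator K v hπ
    rw [← hϖ, h0, map_zero] at this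
    exact WithZero.exp_ne_zero this.symm
  have hvε : v.valuation K ε = 1 := by
    have := congrArg (v.valuation K) hε
    simpa using this
  have hε' : ε ∈ (v.valuation K).valuationSubring := hvε.le
  have hc' : c ∈ (v.valuation K).valuationSubring := hc.le
  set P := ϖ ^ j with hP
  have hP0 : P ≠ 0 := pow_ne_zero _ hϖ0
  have hP' : P ∈ (v.valuation K).valuationSubring := pow_mem hp j
  have ha' : a = 2 * ε + P ^ 2 * c := by rw [ha, hP]; ring
  have hY : (y + algebraMap K L ε) ^ 3 + algebraMap K L (-3 * ε) * (y + algebraMap K L ε) ^ 2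
      + algebraMap K L 0 * (y + algebraMap K L ε) + algebraMap K L (-(P ^ 2 * c)) = 0 := by
    have hεL := congrArg (algebraMap K L) hε
    have haL := congrArg (algebraMap K L) ha'
    simp only [map_add, map_mul, map_neg, map_pow, map_one, map_ofNat, map_zero] at hεL haL ⊢
    linear_combination hy + haL + (-3 * y - 2 * algebraMap K L ε) * hεL
  have hYK : y + algebraMap K L ε ∉ Set.range (algebraMap K L) := by
    rintro ⟨z, hz⟩
    exact hyK ⟨z - ε, by rw [map_sub, hz]; ring⟩
  -- W = Y(Y − 3ε)/πʲ, which satisfies YW = πʲc. Replacing Y² by W removes π²ʲ from the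
  -- discriminant.
  have hW := cubic_combination hY (p := 0) (q := -3 * ε * P⁻¹) (r := P⁻¹) (t₂ := 0)
    (t₁ := 3 * ε * c) (t₀ := -(P * c ^ 2))
    (by linear_combination (0 : K) * hε)
    (by field_simp; ring)
    (by
      field_simp
      linear_combination (0 : K) * hε)
  refine count_differentIdeal_eq_zero K L B v h3 hY hYK ?_ ?_ ?_ rfl hW ?_ ?_ ?_ ?_ <;>
    try rw [← Valuation.mem_valuationSubring_iff]
  · apply_rules [neg_mem, add_mem, sub_mem, mul_mem, pow_mem, ofNat_mem, one_mem]
  · exact zero_mem _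
  · apply_rules [neg_mem, add_mem, sub_mem, mul_mem, pow_mem, ofNat_mem, one_mem]
  · exact zero_mem _
  · apply_rules [neg_mem, add_mem, sub_mem, mul_mem, pow_mem, ofNat_mem, one_mem]
  · apply_rules [neg_mem, add_mem, sub_mem, mul_mem, pow_mem, ofNat_mem, one_mem]
  · have : P⁻¹ ^ 2 * disc3 (-3 * ε) 0 (-(P ^ 2 * c)) = -(3 ^ 3 * c * (a + 2 * ε)) := by
      rw [disc3, ha']
      field_simp
      linear_combination (-(108 : K) * c * P ^ 2 * ε) * hε
    rw [this]
    simp [hv3, hc, ha2]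

end LocalComputations

end

section

/-! ### Places dividing α in characteristic two -/

section CharTwo

variable {A : Type*} (K L : Type*) (B : Type*) [CommRing A] [IsDomain A] [IsPrincipalIdealRing A]
  [Field K] [Algebra A K] [IsFractionRing A K] [Field L] [Algebra K L] [Algebra A L]
  [IsScalarTower A K L] [FiniteDimensional K L] [Algebra.IsSeparable K L]
  [CommRing B] [Algebra A B] [Algebra B L] [IsScalarTower A B L]
  [IsIntegralClosure B A L] [IsDedekindDomain B] [Module.Finite A B] [Module.IsTorsionFree A B]
  (v : HeightOneSpectrum A)

variable {K} in
/-- A root of a monic quadratic with integral coefficients is integral. -/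
theorem mem_valuationSubring_of_quadratic {O : ValuationSubring K} {x b c : K}
    (h : x ^ 2 + b * x + c = 0) (hb : b ∈ O) (hc : c ∈ O) : x ∈ O := by
  rcases O.mem_or_inv_mem x with hx | hx
  · exact hx
  · by_cases h0 : x = 0
    · exact h0 ▸ zero_mem O
    · have : x = -b + -c * x⁻¹ := by
        field_simp
        linear_combination h
      rw [this]
      exact add_mem (neg_mem hb) (mul_mem (neg_mem hc) hx)

/-- Wild ramification in characteristic two. -/
theorem count_differentIdeal_of_charTwo (h2K : (2 : K) = 0) (h3 : Module.finrank K L = 3) {π : A}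
    {y : L} {a a' e δ' : K} (hπ : v.asIdeal = Ideal.span {π})
    (hy : y ^ 3 - 3 * y - algebraMap K L a = 0) (hyK : y ∉ Set.range (algebraMap K L))
    (i j : ℕ) (ha : a = algebraMap A K π ^ (j + 1 + i) * a') (ha' : v.valuation K a' = 1)
    (hδ : e ^ 2 + a * e + a ^ 2 + a = algebraMap A K π ^ (2 * j + 1) * δ')
    (hδ' : v.valuation K δ' = 1) :
    FractionalIdeal.count K v (Ideal.relNorm A (differentIdeal A B) : FractionalIdeal A⁰ K)
      = 2 * (i + 1) := by
  set ϖ := algebraMap A K π with hϖ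
  have hp : ϖ ∈ (v.valuation K).valuationSubring := algebraMap_mem_valuationSubring K v π
  have hp1 : v.valuation K ϖ < 1 := valuation_generator_lt_one K v hπ
  have hϖ0 : ϖ ≠ 0 := fun h0 => by
    have := valuation_generator K v hπ
    rw [← hϖ, h0, map_zero] at this
    exact WithZero.exp_ne_zero this.symm
  have ha'm : a' ∈ (v.valuation K).valuationSubring := ha'.le
  have hδ'm : δ' ∈ (v.valuation K).valuationSubring := hδ'.le
  set P := ϖ ^ j with hP
  set I := ϖ ^ i with hI
  have hP0 : P ≠ 0 := pow_ne_zero _ hϖ0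
  have hPm : P ∈ (v.valuation K).valuationSubring := pow_mem hp j
  have hIm : I ∈ (v.valuation K).valuationSubring := pow_mem hp i
  replace ha : a = ϖ * P * I * a' := by rw [ha, hP, hI]; ring
  replace hδ : e ^ 2 + a * e + a ^ 2 + a = ϖ * P ^ 2 * δ' := by rw [hδ, hP]; ring
  have ham : a ∈ (v.valuation K).valuationSubring := by
    rw [ha]; apply_rules [mul_mem]
  have hem : e ∈ (v.valuation K).valuationSubring := by
    refine mem_valuationSubring_of_quadratic (b := a) (c := a ^ 2 + a - ϖ * P ^ 2 * δ')
      (by linear_combination hδ) ham ?_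
    apply_rules [add_mem, sub_mem, mul_mem, pow_mem]
  -- The relation for δ makes e² divisible by π, so e is in the maximal ideal and 1 + e is a unit.
  have he1 : v.valuation K e < 1 := by
    have : e ^ 2 = ϖ * (P ^ 2 * δ' - P * I * a' * e - P * I * a' * a - P * I * a') := by
      rw [ha] at hδ ⊢
      linear_combination hδ
    have h := congrArg (v.valuation K) this
    rw [map_pow, map_mul] at h
    by_contra hge
    have h1 : (1 : WithZero (Multiplicative ℤ)) ≤ v.valuation K e ^ 2 :=
      one_le_pow₀ (not_lt.1 hge)
    rw [h] at h1
    refine absurd h1 (not_le.2 (mul_lt_one_of_lt_of_le hp1 ?_))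
    rw [← Valuation.mem_valuationSubring_iff]
    apply_rules [add_mem, sub_mem, mul_mem, pow_mem]
  have h1e : v.valuation K (1 + e) = 1 := by
    rw [Valuation.map_add_eq_of_lt_left _ (by simpa using he1), map_one]
  have h1e0 : 1 + e ≠ 0 := fun h0 => by rw [h0, map_zero] at h1e; exact zero_ne_one h1e
  have h2L : (2 : L) = 0 := by rw [← map_ofNat (algebraMap K L), h2K, map_zero]
  have hY : (y + 1) ^ 3 + algebraMap K L 1 * (y + 1) ^ 2 + algebraMap K L 0 * (y + 1)
      + algebraMap K L a = 0 := by
    simp only [map_one, map_zero]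
    linear_combination hy + (2 * y ^ 2 + 4 * y + 1 + algebraMap K L a) * h2L
  have hYK : y + 1 ∉ Set.range (algebraMap K L) := by
    rintro ⟨z, hz⟩
    exact hyK ⟨z - 1, by rw [map_sub, hz, map_one]; ring⟩
  set t₁ := δ' + ϖ * I ^ 2 * a' ^ 2 + I * a' * (1 + e) with ht₁
  set s := I * a' * δ' * (1 + e) + ϖ * P * I ^ 2 * a' ^ 2 * δ' + ϖ ^ 2 * P * I ^ 4 * a' ^ 4
    + P ^ 2 * I ^ 2 * a' ^ 2 + P * I ^ 2 * a' ^ 2 with hs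
  have hsm : s ∈ (v.valuation K).valuationSubring := by
    apply_rules [add_mem, sub_mem, mul_mem, pow_mem, one_mem]
  set t₀ := δ' + ϖ * s with ht₀
  -- The element is Y² + (Y + 1)(Y + e)/πʲ, the counterpart of the tame choice; e is the correction
  -- that allows division by πʲ, and adding Y² gives a constant term of exact order one.
  have hθ := cubic_combination hY (p := e * P⁻¹) (q := P⁻¹ * (1 + e)) (r := 1 + P⁻¹) (t₂ := 1)
    (t₁ := ϖ * t₁) (t₀ := ϖ * t₀)
    (by
      field_simp
      grind)
    (by
      field_simp
      grind)
    (by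
      field_simp
      grind)
  have h₁ : t₁ ∈ (v.valuation K).valuationSubring := by
    apply_rules [add_mem, sub_mem, mul_mem, pow_mem, ofNat_mem, one_mem]
  have h₀ : v.valuation K t₀ = 1 := valuation_add_mul_eq_one v hπ hδ' hsm
  have hq : P⁻¹ * (1 + e) ≠ 0 := mul_ne_zero (inv_ne_zero hP0) h1e0
  rw [count_differentIdeal_of_eisenstein_or_partial K L B v h3 hπ hθ
    (combination_notMem_range h3 hYK (Or.inl hq)) (by simp) h₁ h₀]
  -- In characteristic two with t₂ = 1 the discriminant is (πt₁ + πt₀)². The two copies of δ′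
  -- cancel, and since s is divisible by πⁱ the sum t₁ + t₀ is πⁱ times a unit.
  have hIs : ∃ s', s = I * s' ∧ s' ∈ (v.valuation K).valuationSubring := by
    refine ⟨a' * δ' * (1 + e) + ϖ * P * I * a' ^ 2 * δ' + ϖ ^ 2 * P * I ^ 3 * a' ^ 4
      + P ^ 2 * I * a' ^ 2 + P * I * a' ^ 2, by rw [hs]; ring, ?_⟩
    apply_rules [add_mem, sub_mem, mul_mem, pow_mem, one_mem]
  obtain ⟨s', hs', hs'm⟩ := hIs
  have e : disc3 1 (ϖ * t₁) (ϖ * t₀) = ϖ ^ (2 * (i + 1)) * (a' * (1 + e)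
      + ϖ * (I * a' ^ 2 + s')) ^ 2 := by
    rw [disc3]
    have : ϖ ^ (2 * (i + 1)) = (ϖ * I) ^ 2 := by rw [hI]; ring
    rw [this, ht₀, hs', ht₁]
    grind
  rw [e, neg_log_valuation_pow_mul v hπ (2 * (i + 1))]
  · push_cast; ring
  · rw [map_pow, valuation_add_mul_eq_one v hπ, one_pow]
    · rw [map_mul, ha', h1e, one_mul]
    · apply_rules [add_mem, sub_mem, mul_mem, pow_mem, one_mem]

/-- Absence of ramification in characteristic two. -/
theorem count_differentIdeal_eq_zero_of_charTwo (h2K : (2 : K) = 0)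
    (h3 : Module.finrank K L = 3)
    {y : L} {a e δ' : K}
    (hy : y ^ 3 - 3 * y - algebraMap K L a = 0) (hyK : y ∉ Set.range (algebraMap K L))
    (ha0 : a ≠ 0) (ham : a ∈ (v.valuation K).valuationSubring)
    (hδ : e ^ 2 + a * e + a ^ 2 + a = a ^ 2 * δ')
    (hδ' : δ' ∈ (v.valuation K).valuationSubring) :
    FractionalIdeal.count K v (Ideal.relNorm A (differentIdeal A B) : FractionalIdeal A⁰ K)
      = 0 := by
  have hem : e ∈ (v.valuation K).valuationSubring := by
    refine mem_valuationSubring_of_quadratic (b := a) (c := a ^ 2 + a - a ^ 2 * δ')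
      (by linear_combination hδ) ham ?_
    apply_rules [add_mem, sub_mem, mul_mem, pow_mem]
  have h2L : (2 : L) = 0 := by rw [← map_ofNat (algebraMap K L), h2K, map_zero]
  have hY : (y + 1) ^ 3 + algebraMap K L 1 * (y + 1) ^ 2 + algebraMap K L 0 * (y + 1)
      + algebraMap K L a = 0 := by
    simp only [map_one, map_zero]
    linear_combination hy + (2 * y ^ 2 + 4 * y + 1 + algebraMap K L a) * h2L
  have hYK : y + 1 ∉ Set.range (algebraMap K L) := by
    rintro ⟨z, hz⟩
    exact hyK ⟨z - 1, by rw [map_sub, hz, map_one]; ring⟩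
  -- W = (Y + 1)(Y + e)/a; dividing by a cancels the discriminant a² of Y³ + Y² + a.
  have hW := cubic_combination hY (p := e * a⁻¹) (q := a⁻¹ * (1 + e)) (r := a⁻¹) (t₂ := 0)
    (t₁ := δ' + 1) (t₀ := δ' * (1 + e) + a * δ' + a)
    (by
      field_simp
      grind)
    (by
      field_simp
      grind)
    (by
      field_simp
      grind)
  refine count_differentIdeal_eq_zero K L B v h3 hY hYK ?_ ?_ ?_ rfl hW ?_ ?_ ?_ ?_ <;>
    try rw [← Valuation.mem_valuationSubring_iff]
  · exact one_mem _
  · exact zero_mem _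
  · exact ham
  · exact zero_mem _
  · exact add_mem hδ' (one_mem _)
  · apply_rules [add_mem, sub_mem, mul_mem, pow_mem, one_mem]
  · have : a⁻¹ ^ 2 * disc3 1 0 a = 1 := by
      rw [disc3]
      field_simp
      grind
    rw [this, map_one]

end CharTwo

end

section

/-! ### Ramification in Artin–Schreier extensions -/

section ArtinSchreier

variable {A : Type*} (K L : Type*) (B : Type*) [CommRing A] [IsDomain A] [IsPrincipalIdealRing A]
  [Field K] [Algebra A K] [IsFractionRing A K] [Field L] [Algebra K L] [Algebra A L]
  [IsScalarTower A K L] [FiniteDimensional K L]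
  [CommRing B] [Algebra A B] [Algebra B L] [IsScalarTower A B L]
  [IsIntegralClosure B A L] [IsDedekindDomain B] [Module.Finite A B] [Module.IsTorsionFree A B]
  (v : HeightOneSpectrum A)

include K L in
theorem pow_ramificationIdx_sub_one_dvd_differentIdeal [Algebra.IsSeparable K L] (P : Ideal B)
    [P.IsPrime] [P.LiesOver v.asIdeal] :
    P ^ (P.ramificationIdx A - 1) ∣ differentIdeal A B := by
  have := IsIntegralClosure.isFractionRing_of_finite_extension A K L B
  have he : v.asIdeal.ramificationIdx' P = P.ramificationIdx A :=
    Ideal.ramificationIdx'_eq_ramificationIdx _ _ v.ne_bot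
  have hmax : v.asIdeal.IsMaximal := v.isMaximal
  refine pow_sub_one_dvd_differentIdeal_aux A K L P (p := v.asIdeal) ?_ v.ne_bot ?_
  · rw [← he]; exact Ideal.IsDedekindDomain.ramificationIdx'_ne_zero_of_liesOver P v.ne_bot
  · rw [Ideal.dvd_iff_le, ← he]
    exact Ideal.le_pow_ramificationIdx'

/-- An Artin–Schreier extension is unramified where its parameter is integral. -/
theorem ramificationIdx_le_one_of_artinSchreier [Algebra.IsSeparable K L] {z : L} {b : K}
    (hK2 : (2 : K) = 0) (hz : z ^ 2 - z = algebraMap K L b)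
    (htop : IntermediateField.adjoin K {z} = ⊤) (hb : v.valuation K b ≤ 1)
    (P : Ideal B) [P.IsPrime] [P.LiesOver v.asIdeal] : P.ramificationIdx A ≤ 1 := by
  by_contra hlt
  have hd : P ∣ differentIdeal A B :=
    (dvd_pow_self P (by omega)).trans (pow_ramificationIdx_sub_one_dvd_differentIdeal K L B v P)
  obtain ⟨m, hm, n, e⟩ := exists_mul_eq_of_valuation_le_one v hb
  have eL := congrArg (algebraMap K L) e
  simp only [map_mul, ← IsScalarTower.algebraMap_apply] at eL
  have hm0 : m ≠ 0 := fun h => hm (h ▸ zero_mem _)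
  -- This is the polynomial of mz; in characteristic two its derivative is the constant −m, prime to
  -- v.
  set f : A[X] := X ^ 2 - C m * X - C (m * n) with hf
  have hfz : aeval (algebraMap A L m * z) f = 0 := by
    simp only [hf, map_sub, map_mul, map_pow, aeval_X, aeval_C, ← eL]
    linear_combination algebraMap A L m ^ 2 * hz
  have hint : IsIntegral A (algebraMap A L m * z) := ⟨f, by rw [hf]; monicity!, hfz⟩
  obtain ⟨x, hx⟩ := (IsIntegralClosure.isIntegral_iff (A := B)).1 hint
  have hfx : aeval x f = 0 := by
    apply IsIntegralClosure.algebraMap_injective B A L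
    rw [← aeval_algebraMap_apply, hx, hfz, map_zero]
  have hxi : IsIntegral A x := IsIntegralClosure.isIntegral A L x
  have hadj : Algebra.adjoin K {algebraMap B L x} = ⊤ := by
    have hzint : IsIntegral K z := Algebra.IsIntegral.isIntegral z
    rw [← top_le_iff, ← IntermediateField.top_toSubalgebra, ← htop,
      IntermediateField.adjoin_simple_toSubalgebra_of_isAlgebraic hzint.isAlgebraic,
      Algebra.adjoin_le_iff, Set.singleton_subset_iff, SetLike.mem_coe]
    have hz' : z = algebraMap K L (algebraMap A K m)⁻¹ * algebraMap B L x := by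
      rw [hx, map_inv₀, ← IsScalarTower.algebraMap_apply, inv_mul_cancel_left₀]
      rw [IsScalarTower.algebraMap_apply A K L]
      simpa using hm0
    rw [hz']
    exact mul_mem (algebraMap_mem _ _) (Algebra.self_mem_adjoin_singleton K _)
  have hmem := aeval_derivative_mem_differentIdeal A K L x hadj
  obtain ⟨g, hg⟩ := minpoly.isIntegrallyClosed_dvd hxi hfx
  -- `f` may be a proper multiple of the minimal polynomial, since z may lie in `K`; divisibility of
  -- the derivatives at x is enough.
  have hder : aeval x (derivative f) = aeval x (derivative (minpoly A x)) * aeval x g := by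
    rw [hg, derivative_mul, map_add, map_mul, map_mul, minpoly.aeval, zero_mul, add_zero]
  have hA2 : (2 : A) = 0 := by
    apply IsFractionRing.injective A K
    rw [map_ofNat, hK2, map_zero]
  have hder' : aeval x (derivative f) = -algebraMap A B m := by
    have h2B : (2 : B) = 0 := by rw [← map_ofNat (algebraMap A B), hA2, map_zero]
    simp only [hf, derivative_X_pow, derivative_mul, derivative_C, derivative_X,
      map_sub, map_add, map_mul, map_pow, aeval_C, aeval_X, map_zero, map_one, Nat.cast_ofNat,
      map_ofNat]
    linear_combination x * h2B
  have hmP : algebraMap A B m ∈ P := by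
    have h1 := Ideal.mul_mem_right (aeval x g) P (Ideal.dvd_iff_le.1 hd hmem)
    rw [← hder, hder'] at h1
    exact neg_mem_iff.1 h1
  apply hm
  rw [Ideal.LiesOver.over (P := P) (p := v.asIdeal)]
  exact hmP

include K L in
/-- A pole of odd order of an Artin–Schreier parameter is ramified. -/
theorem exists_one_lt_ramificationIdx_of_artinSchreier {z : L} {b : K}
    (hz : z ^ 2 - z = algebraMap K L b) (hb : 1 < v.valuation K b)
    (hodd : Odd (WithZero.log (v.valuation K b))) :
    ∃ P : Ideal B, P.IsPrime ∧ P.LiesOver v.asIdeal ∧ 1 < P.ramificationIdx A := by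
  have := IsIntegralClosure.isFractionRing_of_finite_extension A K L B
  have hAB : Algebra.IsIntegral A B := IsIntegralClosure.isIntegral_algebra A L
  obtain ⟨P, hPm, hP⟩ := Ideal.exists_maximal_ideal_liesOver_of_isIntegral (S := B) v.asIdeal
  refine ⟨P, hPm.isPrime, hP, ?_⟩
  have he : v.asIdeal.ramificationIdx' P = P.ramificationIdx A :=
    Ideal.ramificationIdx'_eq_ramificationIdx _ _ v.ne_bot
  have he0 : v.asIdeal.ramificationIdx' P ≠ 0 :=
    Ideal.IsDedekindDomain.ramificationIdx'_ne_zero_of_liesOver P v.ne_bot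
  by_contra hlt
  have he1 : v.asIdeal.ramificationIdx' P = 1 := by omega
  let w : HeightOneSpectrum B := ⟨P, hPm.isPrime, Ideal.ne_bot_of_liesOver_of_ne_bot v.ne_bot P⟩
  have hw : w.asIdeal.LiesOver v.asIdeal := hP
  -- If P were unramified, w would restrict to v without rescaling; but a pole of z² − z has twice
  -- the order of the pole of z, contradicting oddness.
  have hvw := HeightOneSpectrum.valuation_liesOver L v w b
  rw [show v.asIdeal.ramificationIdx' w.asIdeal = 1 from he1, pow_one, ← hz] at hvw
  rcases le_or_gt (w.valuation L z) 1 with hz1 | hz1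
  · have : z ^ 2 - z ∈ (w.valuation L).valuationSubring := by
      apply_rules [sub_mem, pow_mem]
    rw [Valuation.mem_valuationSubring_iff, ← hvw] at this
    exact absurd hb (not_lt.2 this)
  · have h2 : w.valuation L (z ^ 2 - z) = w.valuation L z ^ 2 := by
      rw [Valuation.map_sub_eq_of_lt_left, map_pow]
      rw [map_pow, pow_two]
      exact lt_mul_of_one_lt_left (zero_lt_one.trans hz1) hz1
    rw [hvw, h2, WithZero.log_pow] at hodd
    exact (Int.not_odd_iff_even.2 ⟨_, two_nsmul _⟩) hodd

end ArtinSchreier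

end

section

/-! ### Existence of a global standard form -/

section StandardForm

variable {F : Type*} [Field F]

/-- The residue field at π is finite of characteristic two, so −n/d is a square in it. -/
theorem exists_sq_sub_dvd [Finite F] [CharP F 2] {π : F[X]} (hπ : Irreducible π) (n : F[X])
    {d : F[X]} (hd : ¬ π ∣ d) : ∃ g : F[X], π ∣ n + d * g ^ 2 := by
  have : Fact (Irreducible π) := ⟨hπ⟩
  have hfin : Finite (AdjoinRoot π) := by
    have := (AdjoinRoot.powerBasis hπ.ne_zero).finite
    exact Module.finite_of_finite F
  have hchar : CharP (AdjoinRoot π) 2 := charP_of_injective_algebraMap (algebraMap F _).injective 2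
  obtain ⟨r, hr⟩ := FiniteField.isSquare_of_char_two (CharP.ringChar_of_prime_eq_zero
    Nat.prime_two (by simpa using CharP.cast_eq_zero (AdjoinRoot π) 2))
    (-AdjoinRoot.mk π n / AdjoinRoot.mk π d)
  obtain ⟨g, rfl⟩ := AdjoinRoot.mk_surjective r
  refine ⟨g, AdjoinRoot.mk_eq_zero.1 ?_⟩
  have hd0 : AdjoinRoot.mk π d ≠ 0 := fun h => hd (AdjoinRoot.mk_eq_zero.1 h)
  rw [div_eq_iff hd0] at hr
  rw [map_add, map_mul, map_pow]
  linear_combination -hr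

theorem exists_generator (v : HeightOneSpectrum F[X]) :
    ∃ π : F[X], v.asIdeal = Ideal.span {π} ∧ Irreducible π := by
  obtain ⟨π, hπ⟩ := (IsPrincipalIdealRing.principal v.asIdeal).principal
  rw [Ideal.submodule_span_eq] at hπ
  have hπ0 : π ≠ 0 := fun h => v.ne_bot (by simp [hπ, h])
  refine ⟨π, hπ, Prime.irreducible ?_⟩
  rw [← Ideal.span_singleton_prime hπ0, ← hπ]
  exact v.isPrime

/-- In characteristic two the poles of even order of `c` can be removed by adding a function
`η² - η` without introducing new poles. -/
theorem exists_artinSchreier_reduction [Finite F] [CharP F 2] (c : RatFunc F) :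
    ∃ η : RatFunc F, ∀ v : HeightOneSpectrum F[X],
      (v.valuation (RatFunc F) c ≤ 1 → v.valuation (RatFunc F) (c + η ^ 2 - η) ≤ 1) ∧
      (v.valuation (RatFunc F) (c + η ^ 2 - η) ≤ 1 ∨
        Odd (WithZero.log (v.valuation (RatFunc F) (c + η ^ 2 - η)))) := by
  have h2K : (2 : RatFunc F) = 0 := by
    rw [← map_ofNat (algebraMap F (RatFunc F)), show (OfNat.ofNat 2 : F) = 0 from
      by simpa using CharP.cast_eq_zero F 2, map_zero]
  -- Each step lowers one pole of even order and decreases the degree of the denominator.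
  induction hN : c.denom.natDegree using Nat.strong_induction_on generalizing c with
  | _ N ih =>
  by_cases hgood : ∀ v : HeightOneSpectrum F[X], v.valuation (RatFunc F) c ≤ 1 ∨
      Odd (WithZero.log (v.valuation (RatFunc F) c))
  · exact ⟨0, fun v => by simpa using hgood v⟩
  push Not at hgood
  obtain ⟨v, hv1, hv2⟩ := hgood
  rw [Int.not_odd_iff_even] at hv2
  obtain ⟨π, hπ, hirr⟩ := exists_generator v
  have hc0 : c ≠ 0 := by rintro rfl; simp at hv1
  have hd0 := RatFunc.denom_ne_zero c
  obtain ⟨d, hdM, hd⟩ := (FiniteMultiplicity.of_prime_left hirr.prime hd0).exists_eq_pow_mul_and_not_dvd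
  set M := multiplicity π c.denom
  set a := algebraMap F[X] (RatFunc F) with ha
  have ha0 : ∀ {x : F[X]}, x ≠ 0 → a x ≠ 0 := fun hx => by simpa [ha] using hx
  have hcnd : c * a c.denom = a c.num := by
    rw [← eq_div_iff (ha0 hd0)]
    exact (RatFunc.num_div_denom c).symm
  have hval : ∀ (w : HeightOneSpectrum F[X]) {x}, x ∉ w.asIdeal →
      w.valuation (RatFunc F) (a x) = 1 :=
    fun w _ hx => (HeightOneSpectrum.valuation_eq_one_iff_notMem w).2 hx
  have hvπ := valuation_generator (RatFunc F) v hπ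
  have hdv : d ∉ v.asIdeal := by rwa [hπ, Ideal.mem_span_singleton]
  have hvd : v.valuation (RatFunc F) (a c.denom) = WithZero.exp (-(M : ℤ)) := by
    rw [hdM, map_mul, map_mul, hval v hdv, mul_one, map_pow, map_pow, hvπ, ← WithZero.exp_nsmul]
    simp
  have hM0 : M ≠ 0 := by
    intro h0
    rw [h0, Nat.cast_zero, neg_zero, WithZero.exp_zero] at hvd
    have := congrArg (v.valuation (RatFunc F)) hcnd
    rw [map_mul, hvd, mul_one] at this
    exact absurd (v.valuation_le_one c.num) (not_le.2 (this ▸ hv1))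
  have hnv : c.num ∉ v.asIdeal := by
    rw [hπ, Ideal.mem_span_singleton]
    intro hdvd
    have h1 : π ∣ c.denom := hdM ▸ (dvd_pow_self π hM0).mul_right d
    exact hirr.not_isUnit ((RatFunc.isCoprime_num_denom c).isUnit_of_dvd' hdvd h1)
  have hMeven : Even M := by
    have := congrArg (fun x => WithZero.log (v.valuation (RatFunc F) x)) hcnd
    simp only [map_mul, hval v hnv, hvd, WithZero.log_one] at this
    rw [WithZero.log_mul (by simpa using hc0) (by simp), WithZero.log_exp] at this
    have h3 : (M : ℤ) = WithZero.log (v.valuation (RatFunc F) c) := by linarith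
    rw [← h3] at hv2
    exact_mod_cast hv2
  obtain ⟨k', hk'⟩ := hMeven
  obtain ⟨k, rfl⟩ : ∃ k, k' = k + 1 := ⟨k' - 1, by omega⟩
  obtain ⟨g, s, hs⟩ := exists_sq_sub_dvd hirr c.num hd
  -- The pole has order 2(k + 1), and g was chosen so that η₀² cancels its leading coefficient. The
  -- linear term only has a pole of order at most k + 1, so the order drops to at most 2k + 1.
  set η₀ : RatFunc F := a g / a π ^ (k + 1) with hη₀
  have hπ0 := ha0 hirr.ne_zero
  have hd0' : a d ≠ 0 := ha0 fun h => hdv (h ▸ zero_mem _)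
  have hc : c = a c.num / (a π ^ (k + 1 + (k + 1)) * a d) := by
    rw [eq_div_iff (mul_ne_zero (pow_ne_zero _ hπ0) hd0'), ← hcnd, hdM, hk', map_mul, map_pow]
  have hs' := congrArg a hs
  simp only [map_add, map_mul, map_pow] at hs'
  have hc1 : c + η₀ ^ 2 - η₀ = a (s - d * g * π ^ k) / a (π ^ (2 * k + 1) * d) := by
    rw [hc, hη₀]
    simp only [map_sub, map_mul, map_pow]
    field_simp
    linear_combination a π ^ (4 * k + 3) * hs'
  have hdeg : (c + η₀ ^ 2 - η₀).denom.natDegree < N := by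
    have hne : π ^ (2 * k + 1) * d ≠ 0 :=
      mul_ne_zero (pow_ne_zero _ hirr.ne_zero) fun h => hdv (h ▸ zero_mem _)
    have h1 : (c + η₀ ^ 2 - η₀).denom ∣ π ^ (2 * k + 1) * d := by
      rw [hc1]; exact RatFunc.denom_div_dvd _ _
    refine (natDegree_le_of_dvd h1 hne).trans_lt ?_
    have h2 : c.denom = π * (π ^ (2 * k + 1) * d) := by rw [hdM, hk']; ring
    rw [← hN, h2, natDegree_mul hirr.ne_zero hne]
    have := hirr.natDegree_pos
    omega
  obtain ⟨η₁, hη₁⟩ := ih _ hdeg (c + η₀ ^ 2 - η₀) rfl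
  refine ⟨η₀ + η₁, fun w => ?_⟩
  have he : c + (η₀ + η₁) ^ 2 - (η₀ + η₁) = c + η₀ ^ 2 - η₀ + η₁ ^ 2 - η₁ := by
    linear_combination η₀ * η₁ * h2K
  rw [he]
  refine ⟨fun hw => (hη₁ w).1 ?_, (hη₁ w).2⟩
  -- The only pole of η₀ is at v, where c is not integral, so w differs from v.
  have hwπ : π ∉ w.asIdeal := by
    intro hmem
    have hle : v.asIdeal ≤ w.asIdeal := by rwa [hπ, Ideal.span_singleton_le_iff_mem]
    have : v = w := HeightOneSpectrum.ext (v.isMaximal.eq_of_le w.isPrime.ne_top hle)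
    exact absurd hv1 (not_lt.2 (this ▸ hw))
  have hη : w.valuation (RatFunc F) η₀ ≤ 1 := by
    rw [hη₀, map_div₀, map_pow, hval w hwπ, one_pow, div_one]
    exact w.valuation_le_one g
  have hmem : c + η₀ ^ 2 - η₀ ∈ (w.valuation (RatFunc F)).valuationSubring :=
    sub_mem (add_mem hw (pow_mem hη 2)) hη
  exact hmem

end StandardForm

end

/-! ### Local orders of the discriminant for an equation in normal form -/

section

variable {A : Type*} (K L : Type*) (B : Type*) [CommRing A] [IsDomain A] [IsPrincipalIdealRing A]
  [Field K] [Algebra A K] [IsFractionRing A K] [Field L] [Algebra K L] [Algebra A L]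
  [IsScalarTower A K L] [FiniteDimensional K L] [Algebra.IsSeparable K L]
  [CommRing B] [Algebra A B] [Algebra B L] [IsScalarTower A B L]
  [IsIntegralClosure B A L] [IsDedekindDomain B] [Module.Finite A B] [Module.IsTorsionFree A B]
  (v : HeightOneSpectrum A)

variable {K} in
/-- `a = α / (γ³ β₁ β₂²)` in lowest terms, with `β₁`, `β₂` square-free and `β₁ β₂²` cube-free. -/
structure IsNormalForm (a : K) (α β₁ β₂ γ : A) : Prop where
  ne_zero : γ ≠ 0
  eq : a * algebraMap A K (γ ^ 3 * (β₁ * β₂ ^ 2)) = algebraMap A K α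
  coprime : IsCoprime α (β₁ * β₂ ^ 2 * γ)
  cubefree : ∀ d : A, d ^ 3 ∣ β₁ * β₂ ^ 2 → IsUnit d
  squarefree_left : Squarefree β₁
  squarefree_right : Squarefree β₂

omit [IsDomain A] [IsPrincipalIdealRing A] in
theorem notMem_mul {x y : A} (hx : x ∉ v.asIdeal) (hy : y ∉ v.asIdeal) : x * y ∉ v.asIdeal :=
  fun h => (v.isPrime.mem_or_mem h).elim hx hy

omit [IsDomain A] [IsPrincipalIdealRing A] in
theorem notMem_pow {x : A} (hx : x ∉ v.asIdeal) (n : ℕ) : x ^ n ∉ v.asIdeal :=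
  fun h => hx (v.isPrime.mem_of_pow_mem n h)

theorem valuation_eq_one {x : A} (hx : x ∉ v.asIdeal) : v.valuation K (algebraMap A K x) = 1 :=
  (HeightOneSpectrum.valuation_eq_one_iff_notMem v).2 hx

omit [IsDomain A] [IsPrincipalIdealRing A] in
theorem isUnit_notMem {x : A} (hx : IsUnit x) : x ∉ v.asIdeal :=
  fun h => v.isPrime.ne_top (Ideal.eq_top_of_isUnit_mem _ h hx)

omit [IsDomain A] [IsPrincipalIdealRing A] in
theorem exists_eq_generator_mul {π x : A} (hπ : v.asIdeal = Ideal.span {π}) (hx : Squarefree x)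
    (hxv : x ∈ v.asIdeal) : ∃ s ∉ v.asIdeal, x = π * s := by
  have hu : ¬ IsUnit π := fun h => isUnit_notMem v h (hπ ▸ Ideal.mem_span_singleton_self π)
  obtain ⟨s, rfl⟩ := Ideal.mem_span_singleton.1 (hπ ▸ hxv)
  refine ⟨s, fun hs => hu ?_, rfl⟩
  obtain ⟨t, rfl⟩ := Ideal.mem_span_singleton.1 (hπ ▸ hs)
  exact hx π ⟨t, by ring⟩

/-- If e were integral, so would be δ. Hence e has a pole, and e² strictly dominates the other
terms. -/
theorem valuation_quadratic_eq_sq {K Γ : Type*} [Field K] [LinearOrderedCommGroupWithZero Γ]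
    (w : Valuation K Γ) {a e δ : K} (hva : w a < 1) (hδ : e ^ 2 + a * e + a ^ 2 + a = δ)
    (hgt : 1 < w δ) : w δ = w e ^ 2 := by
  have hrest : w (a ^ 2 + a) < 1 := by
    refine lt_of_le_of_lt (w.map_add _ _) (max_lt ?_ hva)
    rw [map_pow]
    exact pow_lt_one₀ zero_le hva two_ne_zero
  have hve : 1 < w e := by
    by_contra! hle
    refine not_le.2 hgt ?_
    rw [← hδ, add_assoc]
    refine (w.map_add _ _).trans (max_le ((w.map_add _ _).trans (max_le ?_ ?_)) hrest.le)
    · rw [map_pow]; exact pow_le_one₀ zero_le hle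
    · rw [map_mul]; exact mul_le_one' hva.le hle
  have hlt : w e < w (e ^ 2) := by
    rw [map_pow, sq]
    exact lt_mul_of_one_lt_left (zero_lt_one.trans hve) hve
  rw [← hδ, show e ^ 2 + a * e + a ^ 2 + a = e ^ 2 + (a * e + (a ^ 2 + a)) by ring, ← map_pow]
  refine w.map_add_eq_of_lt_left ?_
  refine lt_of_le_of_lt (w.map_add _ _) (max_lt ?_ (hrest.trans (hve.trans hlt)))
  rw [map_mul]
  exact lt_of_le_of_lt (mul_le_of_le_one_left' hva.le) hlt

theorem exists_eq_zpow_mul {π : A} (hπ : v.asIdeal = Ideal.span {π}) {x : K} (hx : x ≠ 0) {n : ℤ}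
    (hn : WithZero.log (v.valuation K x) = -n) :
    ∃ u, v.valuation K u = 1 ∧ x = algebraMap A K π ^ n * u := by
  have hπ0 : algebraMap A K π ≠ 0 := by
    intro h
    have := valuation_generator K v hπ
    rw [h, map_zero] at this
    exact WithZero.exp_ne_zero this.symm
  refine ⟨x / algebraMap A K π ^ n, ?_, by field_simp⟩
  have h0 : v.valuation K x ≠ 0 := (_root_.map_ne_zero _).2 hx
  rw [map_div₀, map_zpow₀, valuation_generator K v hπ, ← WithZero.exp_log h0, hn,
    ← WithZero.exp_zsmul]
  simp

namespace IsNormalForm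

variable {K v} {a : K} {α β₁ β₂ γ : A} (H : IsNormalForm a α β₁ β₂ γ) {y : L}
  (hy : y ^ 3 - 3 * y - algebraMap K L a = 0)
include H

omit [IsDomain A] [IsPrincipalIdealRing A] [IsFractionRing A K] [FiniteDimensional K L]
  [Algebra.IsSeparable K L] in
include hy in
theorem gen_cubic :
    (algebraMap A L (γ * β₁ * β₂) * y) ^ 3
      + algebraMap K L (algebraMap A K 0) * (algebraMap A L (γ * β₁ * β₂) * y) ^ 2
      + algebraMap K L (algebraMap A K (-3 * (γ * β₁ * β₂) ^ 2))
        * (algebraMap A L (γ * β₁ * β₂) * y)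
      + algebraMap K L (algebraMap A K (-(β₁ ^ 2 * β₂ * α))) = 0 := by
  have h1 := congrArg (algebraMap K L) H.eq
  simp only [IsScalarTower.algebraMap_apply A K L, map_mul, map_neg, map_pow, map_zero,
    map_ofNat] at h1 ⊢
  generalize algebraMap K L (algebraMap A K γ) = g at *
  generalize algebraMap K L (algebraMap A K β₁) = b at *
  generalize algebraMap K L (algebraMap A K β₂) = c at *
  generalize algebraMap K L (algebraMap A K α) = d at *
  linear_combination (g * b * c) ^ 3 * hy + b ^ 2 * c * h1

omit [IsDomain A] [IsPrincipalIdealRing A] [IsFractionRing A K] in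
theorem notMem_of_mem (h : α ∈ v.asIdeal) : β₁ ∉ v.asIdeal ∧ β₂ ∉ v.asIdeal ∧ γ ∉ v.asIdeal := by
  obtain ⟨s, t, hst⟩ := H.coprime
  have key : β₁ * β₂ ^ 2 * γ ∉ v.asIdeal := fun h' =>
    isUnit_notMem v isUnit_one (hst ▸ add_mem (Ideal.mul_mem_left _ s h) (Ideal.mul_mem_left _ t h'))
  refine ⟨fun h' => key ?_, fun h' => key ?_, fun h' => key ?_⟩
  · exact Ideal.mul_mem_right _ _ (Ideal.mul_mem_right _ _ h')
  · exact Ideal.mul_mem_right _ _ (Ideal.mul_mem_left _ _ (Ideal.pow_mem_of_mem _ h' 2 two_pos))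
  · exact Ideal.mul_mem_left _ _ h'

-- A common prime factor of β₁ and β₂ would divide β₁β₂² to the third power.
omit [IsDomain A] [IsPrincipalIdealRing A] [IsFractionRing A K] in
theorem right_notMem {π : A} (hπ : v.asIdeal = Ideal.span {π}) (h : β₁ ∈ v.asIdeal) :
    β₂ ∉ v.asIdeal := by
  intro h'
  obtain ⟨s, rfl⟩ := Ideal.mem_span_singleton.1 (hπ ▸ h)
  obtain ⟨t, rfl⟩ := Ideal.mem_span_singleton.1 (hπ ▸ h')
  exact isUnit_notMem v (H.cubefree π ⟨s * t ^ 2, by ring⟩) (hπ ▸ Ideal.mem_span_singleton_self π)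

omit [IsPrincipalIdealRing A] [IsFractionRing A K] in
theorem left_ne_zero : β₁ ≠ 0 := H.squarefree_left.ne_zero
omit [IsPrincipalIdealRing A] [IsFractionRing A K] in
theorem right_ne_zero : β₂ ≠ 0 := H.squarefree_right.ne_zero

omit [IsPrincipalIdealRing A] [IsFractionRing A K] in
theorem mul_ne_zero : γ * β₁ * β₂ ≠ 0 :=
  _root_.mul_ne_zero (_root_.mul_ne_zero H.ne_zero H.left_ne_zero) H.right_ne_zero

omit [IsPrincipalIdealRing A] [FiniteDimensional K L] [Algebra.IsSeparable K L] in
theorem gen_notMem_range (h3 : Module.finrank K L = 3) (hyK : y ∉ Set.range (algebraMap K L)) :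
    algebraMap A L (γ * β₁ * β₂) * y ∉ Set.range (algebraMap K L) := by
  have := combination_notMem_range h3 hyK (p := 0) (q := algebraMap A K (γ * β₁ * β₂)) (r := 0)
    (Or.inl (by simpa using H.mul_ne_zero))
  simpa [← IsScalarTower.algebraMap_apply A K L] using this

-- For a = 0 the equation is y(y² − 3) = 0, and y would have degree at most two.
omit [IsPrincipalIdealRing A] [Algebra A L] [IsScalarTower A K L] [FiniteDimensional K L] [Algebra.IsSeparable K L] in
include hy in
theorem numerator_ne_zero (h3 : Module.finrank K L = 3)
    (hyK : y ∉ Set.range (algebraMap K L)) : α ≠ 0 := by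
  intro h0
  have ha : a = 0 := by
    have := H.eq
    rw [h0, map_zero, mul_eq_zero] at this
    refine this.resolve_right ?_
    simpa using ⟨H.ne_zero, H.left_ne_zero, H.right_ne_zero⟩
  have h1 : y * (y ^ 2 - 3) = 0 := by rw [ha, map_zero] at hy; linear_combination hy
  rcases mul_eq_zero.1 h1 with h | h
  · exact hyK ⟨0, by simp [h]⟩
  · refine combination_notMem_range h3 hyK (p := 0) (q := 0) (r := 1) (Or.inr one_ne_zero)
      ⟨3, ?_⟩
    simp only [map_ofNat, map_zero, map_one]
    linear_combination -h

omit [IsDomain A] [IsPrincipalIdealRing A] in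
theorem param_ne_zero (hα : α ≠ 0) : a ≠ 0 := fun h => hα <| by
  have := H.eq
  rw [h, zero_mul] at this
  simpa using this.symm

theorem valuation_param (h : α ∈ v.asIdeal) :
    v.valuation K a = v.valuation K (algebraMap A K α) := by
  obtain ⟨h1, h2, h3⟩ := H.notMem_of_mem h
  rw [← H.eq, map_mul, valuation_eq_one K v (notMem_mul v (notMem_pow v h3 3)
    (notMem_mul v h1 (notMem_pow v h2 2))), mul_one]

section count

variable {π : A} (hπ : v.asIdeal = Ideal.span {π}) (h3 : Module.finrank K L = 3)
  (hyK : y ∉ Set.range (algebraMap K L)) (hv3 : v.valuation K 3 = 1)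
include hπ h3 hy hyK hv3

/-- Here ω has normalized order 2/3, so ω²/β₁ has order 1/3 and satisfies an Eisenstein cubic. -/
theorem count_of_left_mem (h : β₁ ∈ v.asIdeal) :
    FractionalIdeal.count K v (Ideal.relNorm A (differentIdeal A B) : FractionalIdeal A⁰ K)
      = 2 := by
  have hα : α ∉ v.asIdeal := fun hα => (H.notMem_of_mem hα).1 h
  have hβ₂ := H.right_notMem hπ h
  obtain ⟨s, hs, hs'⟩ := exists_eq_generator_mul v hπ H.squarefree_left h
  have hb : algebraMap A K β₁ ≠ 0 := by simpa using H.left_ne_zero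
  have hω := H.gen_cubic L hy
  refine count_differentIdeal_eq_two K L B v h3 hπ
    (t₂ := algebraMap A K (-(6 * γ ^ 2 * s * β₂ ^ 2)))
    (t₁ := algebraMap A K (9 * γ ^ 4 * π * s ^ 2 * β₂ ^ 4))
    (t₀ := algebraMap A K (-1 * (s * β₂ * β₂ * α ^ 2)))
    (cubic_combination hω (p := 0) (q := 0) (r := (algebraMap A K β₁)⁻¹) ?_ ?_ ?_)
    (combination_notMem_range h3 (H.gen_notMem_range L h3 hyK) (Or.inr (inv_ne_zero hb))) hv3
    (algebraMap_mem_valuationSubring K v _) (algebraMap_mem_valuationSubring K v _)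
    (valuation_eq_one K v (notMem_mul v (isUnit_notMem v isUnit_one.neg) (notMem_mul v
      (notMem_mul v (notMem_mul v hs hβ₂) hβ₂) (notMem_pow v hα 2))))
  all_goals
    have hs'' := congrArg (algebraMap A K) hs'
    simp only [map_mul, map_neg, map_pow, map_zero, map_ofNat, map_one] at hs'' ⊢
    generalize algebraMap A K β₁ = b at *
    subst hs''
    obtain ⟨hp0, hs0⟩ := mul_ne_zero_iff.1 hb
    field_simp
    ring

/-- Here ω itself has normalized order 1/3. -/
theorem count_of_right_mem (h : β₂ ∈ v.asIdeal) :
    FractionalIdeal.count K v (Ideal.relNorm A (differentIdeal A B) : FractionalIdeal A⁰ K)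
      = 2 := by
  have hα : α ∉ v.asIdeal := fun hα => (H.notMem_of_mem hα).2.1 h
  have hβ₁ : β₁ ∉ v.asIdeal := fun h' => H.right_notMem hπ h' h
  obtain ⟨s, hs, hs'⟩ := exists_eq_generator_mul v hπ H.squarefree_right h
  have hω := H.gen_cubic L hy
  refine count_differentIdeal_eq_two K L B v h3 hπ
    (t₂ := algebraMap A K 0)
    (t₁ := algebraMap A K (-3 * (γ * β₁ * s) ^ 2 * π))
    (t₀ := algebraMap A K (-1 * (β₁ ^ 2 * s * α))) ?_
    (H.gen_notMem_range L h3 hyK) hv3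
    (algebraMap_mem_valuationSubring K v _) (algebraMap_mem_valuationSubring K v _)
    (valuation_eq_one K v (notMem_mul v (isUnit_notMem v isUnit_one.neg) (notMem_mul v
      (notMem_mul v (notMem_pow v hβ₁ 2) hs) hα)))
  rw [← hω, ← map_mul (algebraMap A K) π, ← map_mul (algebraMap A K) π,
    ← map_mul (algebraMap A K) π, mul_zero,
    show π * (-3 * (γ * β₁ * s) ^ 2 * π) = -3 * (γ * β₁ * β₂) ^ 2 by rw [hs']; ring,
    show π * (-1 * (β₁ ^ 2 * s * α)) = -(β₁ ^ 2 * β₂ * α) by rw [hs']; ring]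

omit hπ in
theorem count_of_notMem (hβ₁ : β₁ ∉ v.asIdeal) (hβ₂ : β₂ ∉ v.asIdeal)
    (hD : 4 * γ ^ 6 * (β₁ * β₂ ^ 2) ^ 2 - α ^ 2 ∉ v.asIdeal) :
    FractionalIdeal.count K v (Ideal.relNorm A (differentIdeal A B) : FractionalIdeal A⁰ K)
      = 0 := by
  have hω := H.gen_cubic L hy
  refine count_differentIdeal_eq_zero K L B v h3 (p := 0) (q := 0) (r := 1) hω
    (H.gen_notMem_range L h3 hyK) ?_ ?_ ?_ rfl
    (s₂ := algebraMap A K (-6 * (γ * β₁ * β₂) ^ 2))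
    (s₁ := algebraMap A K (9 * (γ * β₁ * β₂) ^ 4))
    (s₀ := algebraMap A K (-(β₁ ^ 2 * β₂ * α) ^ 2))
    (cubic_combination hω ?_ ?_ ?_) ?_ ?_ ?_ ?_
  iterate 3 exact algebraMap_mem_valuationSubring K v _
  iterate 3
    simp only [map_mul, map_neg, map_pow, map_zero, map_ofNat]
    ring
  iterate 3 exact algebraMap_mem_valuationSubring K v _
  have : (1 : K) ^ 2 * disc3 (algebraMap A K 0) (algebraMap A K (-3 * (γ * β₁ * β₂) ^ 2))
      (algebraMap A K (-(β₁ ^ 2 * β₂ * α))) = 3 ^ 3 * algebraMap A K (β₁ ^ 4 * β₂ ^ 2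
        * (4 * γ ^ 6 * (β₁ * β₂ ^ 2) ^ 2 - α ^ 2)) := by
    simp only [disc3, map_mul, map_neg, map_pow, map_zero, map_ofNat, map_sub]
    ring
  rw [this, map_mul, map_pow, hv3, one_pow, one_mul]
  exact valuation_eq_one K v (notMem_mul v (notMem_mul v (notMem_pow v hβ₁ 4) (notMem_pow v hβ₂ 2)) hD)

-- D is a difference of two terms, and coprimality keeps v from dividing both; 2 is a unit at v.
omit hyK hv3 h3 hy hπ in
theorem notMem_of_discrFactor_mem
    (hv2 : v.valuation K 2 = 1)
    (h : 4 * γ ^ 6 * (β₁ * β₂ ^ 2) ^ 2 - α ^ 2 ∈ v.asIdeal) :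
    β₁ ∉ v.asIdeal ∧ β₂ ∉ v.asIdeal ∧ γ ∉ v.asIdeal ∧ α ∉ v.asIdeal := by
  have h2 : (2 : A) ∉ v.asIdeal := by
    rw [← HeightOneSpectrum.valuation_eq_one_iff_notMem (K := K), map_ofNat, hv2]
  have hα : α ∉ v.asIdeal := by
    intro hα
    obtain ⟨h1, h2', h3⟩ := H.notMem_of_mem hα
    refine notMem_mul v (notMem_mul v (notMem_pow v h2 2) (notMem_pow v h3 6))
      (notMem_pow v (notMem_mul v h1 (notMem_pow v h2' 2)) 2) ?_
    have := add_mem h (Ideal.mul_mem_left _ α hα)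
    convert this using 1
    ring
  have key : γ * (β₁ * β₂) ∉ v.asIdeal := by
    intro h'
    refine notMem_pow v hα 2 ?_
    have := sub_mem (Ideal.mul_mem_left _ (4 * γ ^ 4 * (γ * (β₁ * β₂)) * β₂ ^ 2) h') h
    convert this using 1
    ring
  exact ⟨fun h' => key (Ideal.mul_mem_left _ _ (Ideal.mul_mem_right _ _ h')),
    fun h' => key (Ideal.mul_mem_left _ _ (Ideal.mul_mem_left _ _ h')),
    fun h' => key (Ideal.mul_mem_right _ _ h'), hα⟩

/-- With G = γ³β, −D = (α − 2G)(α + 2G), and the factors add up to 2α, a unit at v. One factor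
therefore carries all of πⁿ, which gives a = 2ε + πⁿ·unit, and the parity of n decides. -/
theorem count_of_discrFactor (hv2 : v.valuation K 2 = 1) {n : ℕ} (hn : n ≠ 0) {u : A}
    (hu : u ∉ v.asIdeal) (hD : 4 * γ ^ 6 * (β₁ * β₂ ^ 2) ^ 2 - α ^ 2 = π ^ n * u) :
    FractionalIdeal.count K v (Ideal.relNorm A (differentIdeal A B) : FractionalIdeal A⁰ K)
      = (n % 2 : ℕ) := by
  have hDv : 4 * γ ^ 6 * (β₁ * β₂ ^ 2) ^ 2 - α ^ 2 ∈ v.asIdeal := by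
    rw [hD, hπ]
    exact Ideal.mul_mem_right _ _ (Ideal.pow_mem_of_mem _ (Ideal.mem_span_singleton_self π) n
      (Nat.pos_of_ne_zero hn))
  obtain ⟨h1, h2, hγ, hα⟩ := H.notMem_of_discrFactor_mem hv2 hDv
  set G := γ ^ 3 * (β₁ * β₂ ^ 2) with hG
  have hGv : G ∉ v.asIdeal := notMem_mul v (notMem_pow v hγ 3) (notMem_mul v h1 (notMem_pow v h2 2))
  have hGK : algebraMap A K G ≠ 0 := by
    intro h0
    have := valuation_eq_one K v hGv
    rw [h0, map_zero] at this
    exact zero_ne_one this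
  obtain ⟨ε, hε, w, hw, hw'⟩ : ∃ ε : A, ε ^ 2 = 1 ∧ ∃ w ∉ v.asIdeal, α + 2 * ε * G = w ∧
      α - 2 * ε * G ∈ v.asIdeal := by
    have h4 : (α - 2 * G) * (α + 2 * G) ∈ v.asIdeal := by
      have := neg_mem hDv
      convert this using 1
      rw [hG]; ring
    have h2α : 2 * α ∉ v.asIdeal := by
      refine notMem_mul v ?_ hα
      rw [← HeightOneSpectrum.valuation_eq_one_iff_notMem (K := K), map_ofNat, hv2]
    rcases v.isPrime.mem_or_mem h4 with h | h
    · refine ⟨1, by ring, _, fun h' => h2α ?_, rfl, by convert h using 1; ring⟩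
      have := add_mem h h'
      convert this using 1; ring
    · refine ⟨-1, by ring, _, fun h' => h2α ?_, rfl, by convert h using 1; ring⟩
      have := add_mem h h'
      convert this using 1; ring
  have hεK : (algebraMap A K ε) ^ 2 = 1 := by rw [← map_pow, hε, map_one]
  have hprime : Prime π := by
    rw [← Ideal.span_singleton_prime, ← hπ]
    · exact v.isPrime
    · rintro rfl; exact v.ne_bot (by simp [hπ])
  have hwπ : ¬ π ∣ w := by rwa [← Ideal.mem_span_singleton, ← hπ]
  have hfac : (α - 2 * ε * G) * w = π ^ n * -u := by
    rw [mul_neg, ← hD, ← hw'.1, hG]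
    linear_combination (-4 * γ ^ 6 * β₁ ^ 2 * β₂ ^ 4) * hε
  obtain ⟨c, hc⟩ : π ^ n ∣ α - 2 * ε * G :=
    hprime.pow_dvd_of_dvd_mul_right n hwπ ⟨_, hfac⟩
  have hcv : c ∉ v.asIdeal := by
    intro hcv
    rw [hc, mul_assoc] at hfac
    have := mul_left_cancel₀ (pow_ne_zero n hprime.ne_zero) hfac
    exact hu (neg_mem_iff.1 (this ▸ Ideal.mul_mem_right _ _ hcv))
  have haeq : a = 2 * algebraMap A K ε + algebraMap A K π ^ n
      * (algebraMap A K c / algebraMap A K G) := by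
    have h5 := congrArg (algebraMap A K) hc
    have h6 := H.eq
    rw [← hG] at h6
    simp only [map_sub, map_mul, map_pow, map_ofNat] at h5
    field_simp
    linear_combination h6 + h5
  have hcG : v.valuation K (algebraMap A K c / algebraMap A K G) = 1 := by
    rw [map_div₀, valuation_eq_one K v hcv, valuation_eq_one K v hGv, div_one]
  rcases Nat.even_or_odd' n with ⟨j, rfl | rfl⟩
  · rw [count_differentIdeal_eq_zero_of_even K L B v h3 hπ hy hyK hv3 hεK j haeq hcG]
    · simp
    · have h7 : a + 2 * algebraMap A K ε = algebraMap A K w / algebraMap A K G := by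
        have h6 := H.eq
        rw [← hG] at h6
        rw [eq_div_iff hGK, ← hw'.1]
        simp only [map_add, map_mul, map_ofNat]
        linear_combination h6
      rw [h7, map_div₀, valuation_eq_one K v hw, valuation_eq_one K v hGv, div_one]
  · rw [count_differentIdeal_eq_one K L B v h3 hπ hy hyK hv2 hv3 hεK j haeq hcG]
    norm_num

end count

section charTwo

variable {π : A} (hπ : v.asIdeal = Ideal.span {π}) (h3 : Module.finrank K L = 3)
  (hyK : y ∉ Set.range (algebraMap K L)) (h2K : (2 : K) = 0) (hαv : α ∈ v.asIdeal)
  {η b : K} (hb : b = 1 / a ^ 2 + 1 + η ^ 2 - η)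
include h3 hy hyK h2K hαv hb

theorem count_eq_zero_of_charTwo (hbv : v.valuation K b ≤ 1) :
    FractionalIdeal.count K v (Ideal.relNorm A (differentIdeal A B) : FractionalIdeal A⁰ K)
      = 0 := by
  have ha0 := H.param_ne_zero (H.numerator_ne_zero L hy h3 hyK)
  -- The choice e = 1 + aη turns e² + ae + a² + a into a²b.
  refine count_differentIdeal_eq_zero_of_charTwo K L B v h2K h3 hy hyK (e := 1 + a * η) ha0 ?_ ?_ hbv
  · change v.valuation K a ≤ 1
    rw [H.valuation_param hαv]
    exact v.valuation_le_one _
  · rw [hb]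
    field_simp
    linear_combination (a * η + a + a ^ 2 * η) * h2K

include hπ in
theorem count_of_charTwo (hbv : 1 < v.valuation K b) (hodd : Odd (WithZero.log (v.valuation K b))) :
    FractionalIdeal.count K v (Ideal.relNorm A (differentIdeal A B) : FractionalIdeal A⁰ K)
      = WithZero.log (v.valuation K b) + 1 ∧
      WithZero.log (v.valuation K b) < -2 * WithZero.log (v.valuation K (algebraMap A K α)) := by
  have ha0 := H.param_ne_zero (H.numerator_ne_zero L hy h3 hyK)
  have hva : v.valuation K a < 1 := by
    rw [H.valuation_param hαv]
    exact (HeightOneSpectrum.valuation_lt_one_iff_mem v α).2 hαv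
  have hva0 : v.valuation K a ≠ 0 := (_root_.map_ne_zero _).2 ha0
  have hvb0 : v.valuation K b ≠ 0 := (zero_lt_one.trans hbv).ne'
  have hb0 : b ≠ 0 := (_root_.map_ne_zero _).1 hvb0
  have hδ : (1 + a * η) ^ 2 + a * (1 + a * η) + a ^ 2 + a = a ^ 2 * b := by
    rw [hb]
    field_simp
    linear_combination (a * η + a + a ^ 2 * η) * h2K
  obtain ⟨ℓ, hℓ⟩ : ∃ ℓ, WithZero.log (v.valuation K b) = ℓ := ⟨_, rfl⟩
  obtain ⟨k, hk⟩ : ∃ k, WithZero.log (v.valuation K a) = -k := ⟨_, (neg_neg _).symm⟩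
  have hδlog : WithZero.log (v.valuation K (a ^ 2 * b)) = -(2 * k - ℓ) := by
    rw [map_mul, map_pow, WithZero.log_mul (pow_ne_zero 2 hva0) hvb0, WithZero.log_pow, hk, hℓ]
    simp
    ring
  have hℓ0 : 0 < ℓ := by
    rw [← hℓ]
    exact (WithZero.lt_log_iff_exp_lt hvb0).2 (by simpa using hbv)
  rw [← H.valuation_param hαv, hk]
  rw [hℓ] at hodd ⊢
  -- Otherwise a²b has a pole, whose order would be twice that of e; but 2k − ℓ is odd.
  have hlt : ℓ < 2 * k := by
    by_contra! hle
    have hgt : 1 < v.valuation K (a ^ 2 * b) := by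
      have h0 : v.valuation K (a ^ 2 * b) ≠ 0 := (_root_.map_ne_zero _).2 (_root_.mul_ne_zero (pow_ne_zero 2 ha0) hb0)
      have h1 : 0 < WithZero.log (v.valuation K (a ^ 2 * b)) := by
        rw [hδlog]; obtain ⟨m, hm⟩ := hodd; omega
      simpa using (WithZero.lt_log_iff_exp_lt h0).1 h1
    have hsq := valuation_quadratic_eq_sq (v.valuation K) hva hδ hgt
    have := congrArg WithZero.log hsq
    rw [hδlog, WithZero.log_pow] at this
    obtain ⟨m, hm⟩ := hodd
    simp at this
    omega
  refine ⟨?_, by linarith⟩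
  obtain ⟨m, hm⟩ := hodd
  -- Now ℓ = 2m + 1 and k = j + 1 + m, so a²b has order 2j + 1 and the discriminant has order 2(m +
  -- 1) = ℓ + 1.
  obtain ⟨m, rfl⟩ : ∃ m' : ℕ, m = m' := ⟨m.toNat, by omega⟩
  obtain ⟨j, hj⟩ : ∃ j : ℕ, k = j + 1 + m := ⟨(k - 1 - m).toNat, by omega⟩
  obtain ⟨a', ha', haa'⟩ := exists_eq_zpow_mul K v hπ ha0 (n := ((j + 1 + m : ℕ) : ℤ))
    (by rw [hk, hj]; push_cast; ring)
  obtain ⟨δ', hδ', hδδ'⟩ := exists_eq_zpow_mul K v hπ (_root_.mul_ne_zero (pow_ne_zero 2 ha0) hb0)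
    (n := ((2 * j + 1 : ℕ) : ℤ)) (by rw [hδlog, hj, hm]; push_cast; ring)
  rw [zpow_natCast] at haa' hδδ'
  rw [count_differentIdeal_of_charTwo K L B v h2K h3 hπ hy hyK m j haa' ha' (hδ.trans hδδ') hδ', hm]
  ring

end charTwo
end IsNormalForm

end

section

/-! ### Ideals determined by their orders -/

section Ideals

variable {A : Type*} (K : Type*) [CommRing A] [IsDedekindDomain A] [Field K] [Algebra A K]
  [IsFractionRing A K]

variable {K} in
theorem eq_of_count_eq {I J : FractionalIdeal A⁰ K} (hI : I ≠ 0) (hJ : J ≠ 0)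
    (h : ∀ v, FractionalIdeal.count K v I = FractionalIdeal.count K v J) : I = J := by
  rw [← FractionalIdeal.finprod_heightOneSpectrum_factorization' K hI,
    ← FractionalIdeal.finprod_heightOneSpectrum_factorization' K hJ]
  exact finprod_congr fun v => by rw [h v]

variable {K} in
theorem exists_coeIdeal_eq_of_count_nonneg {J : FractionalIdeal A⁰ K} (hJ : J ≠ 0)
    (h : ∀ v, 0 ≤ FractionalIdeal.count K v J) : ∃ I : Ideal A, (I : FractionalIdeal A⁰ K) = J := by
  rw [← FractionalIdeal.le_one_iff_exists_coeIdeal,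
    ← FractionalIdeal.finprod_heightOneSpectrum_factorization' K hJ]
  refine finprod_induction (p := fun x : FractionalIdeal A⁰ K => x ≤ 1) le_rfl
    (fun x y hx hy => mul_le_one' hx hy) fun v => ?_
  obtain ⟨n, hn⟩ := Int.eq_ofNat_of_zero_le (h v)
  rw [hn, zpow_natCast]
  exact pow_le_one' FractionalIdeal.coeIdeal_le_one n

theorem eq_of_count_coeIdeal_eq {I J : Ideal A} (hI : I ≠ 0) (hJ : J ≠ 0)
    (h : ∀ v, FractionalIdeal.count K v (I : FractionalIdeal A⁰ K)
      = FractionalIdeal.count K v (J : FractionalIdeal A⁰ K)) : I = J :=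
  FractionalIdeal.coeIdeal_injective (K := K) <| eq_of_count_eq
    (FractionalIdeal.coeIdeal_ne_zero.2 hI) (FractionalIdeal.coeIdeal_ne_zero.2 hJ) h

theorem count_coeIdeal_mul (v : HeightOneSpectrum A) {I J : Ideal A} (hI : I ≠ 0) (hJ : J ≠ 0) :
    FractionalIdeal.count K v ((I * J : Ideal A) : FractionalIdeal A⁰ K)
      = FractionalIdeal.count K v (I : FractionalIdeal A⁰ K)
        + FractionalIdeal.count K v (J : FractionalIdeal A⁰ K) := by
  rw [FractionalIdeal.coeIdeal_mul, FractionalIdeal.count_mul K v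
    (FractionalIdeal.coeIdeal_ne_zero.2 hI) (FractionalIdeal.coeIdeal_ne_zero.2 hJ)]

theorem eq_sq_mul_iff_of_count {Δ D J : Ideal A} (hΔ : Δ ≠ 0) (hD : D ≠ 0) (hJ : J ≠ 0)
    (h : ∀ v, FractionalIdeal.count K v (Δ : FractionalIdeal A⁰ K)
      = 2 * FractionalIdeal.count K v (J : FractionalIdeal A⁰ K)
        + FractionalIdeal.count K v (D : FractionalIdeal A⁰ K)) (I : Ideal A) :
    Δ = I ^ 2 * D ↔ I = J := by
  have key : ∀ {I : Ideal A}, I ≠ 0 → ∀ v,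
      FractionalIdeal.count K v ((I ^ 2 * D : Ideal A) : FractionalIdeal A⁰ K)
        = 2 * FractionalIdeal.count K v (I : FractionalIdeal A⁰ K)
          + FractionalIdeal.count K v (D : FractionalIdeal A⁰ K) := by
    intro I hI v
    rw [count_coeIdeal_mul K v (pow_ne_zero 2 hI) hD, sq, count_coeIdeal_mul K v hI hI, two_mul]
  constructor
  · intro e
    have hI : I ≠ 0 := by
      rintro rfl
      exact hΔ (by rw [e]; simp)
    refine eq_of_count_coeIdeal_eq K hI hJ fun v => ?_
    have := key hI v
    rw [← e, h v] at this
    omega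
  · rintro rfl
    exact eq_of_count_coeIdeal_eq K hΔ (mul_ne_zero (pow_ne_zero 2 hJ) hD) fun v => by
      rw [key hJ, h v]

/-- The finiteness hypothesis is needed because `finprod` takes the default value 1 when infinitely
many factors are nontrivial. -/
theorem count_finprod_of_prop (c : HeightOneSpectrum A → Prop) (n : HeightOneSpectrum A → ℤ)
    (hfin : ∀ᶠ v in Filter.cofinite, c v → n v = 0) :
    (∏ᶠ (v : HeightOneSpectrum A) (_ : c v), (v.asIdeal : FractionalIdeal A⁰ K) ^ n v) ≠ 0 ∧
    ∀ v, (c v → FractionalIdeal.count K v (∏ᶠ (v : HeightOneSpectrum A) (_ : c v),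
        (v.asIdeal : FractionalIdeal A⁰ K) ^ n v) = n v) ∧
      (¬ c v → FractionalIdeal.count K v (∏ᶠ (v : HeightOneSpectrum A) (_ : c v),
        (v.asIdeal : FractionalIdeal A⁰ K) ^ n v) = 0) := by
  classical
  have e : (∏ᶠ (v : HeightOneSpectrum A) (_ : c v), (v.asIdeal : FractionalIdeal A⁰ K) ^ n v)
      = ∏ᶠ v : HeightOneSpectrum A, (v.asIdeal : FractionalIdeal A⁰ K) ^ (if c v then n v else 0) := by
    refine finprod_congr fun v => ?_
    rw [finprod_eq_if]
    split_ifs <;> simp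
  have hv : ∀ v : HeightOneSpectrum A, (v.asIdeal : FractionalIdeal A⁰ K) ≠ 0 := fun v =>
    FractionalIdeal.coeIdeal_ne_zero.2 v.ne_bot
  rw [e]
  refine ⟨finprod_induction (p := fun x : FractionalIdeal A⁰ K => x ≠ 0) one_ne_zero
    (fun x y => mul_ne_zero) fun v => zpow_ne_zero _ (hv v), fun v => ?_⟩
  rw [FractionalIdeal.count_finprod K v _ (by
    filter_upwards [hfin] with w hw
    split_ifs with h
    · exact hw h
    · rfl)]
  exact ⟨fun h => if_pos h, fun h => if_neg h⟩

end Ideals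

/-! ### Orders of polynomials and rational functions -/

section Polynomials

variable {F : Type*} [Field F] (v : HeightOneSpectrum F[X])

theorem valuation_natCast_eq_one (n : ℕ) (hn : (n : F) ≠ 0) :
    v.valuation (RatFunc F) (n : RatFunc F) = 1 := by
  have := valuation_eq_one (RatFunc F) v
    (isUnit_notMem v (Polynomial.isUnit_C.2 (isUnit_iff_ne_zero.2 hn)))
  simpa using this

theorem ord_mul {x y : RatFunc F} (hx : x ≠ 0) (hy : y ≠ 0) :
    ord v (x * y) = ord v x + ord v y := by
  rw [ord, map_mul, WithZero.log_mul ((_root_.map_ne_zero _).2 hx) ((_root_.map_ne_zero _).2 hy),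
    neg_add]
  rfl

theorem ord_pow (x : RatFunc F) (n : ℕ) : ord v (x ^ n) = n * ord v x := by
  rw [ord, map_pow, WithZero.log_pow, ord, nsmul_eq_mul]
  ring

theorem ord_eq_zero {x : F[X]} (hx : x ∉ v.asIdeal) : ord v (algebraMap F[X] (RatFunc F) x) = 0 := by
  rw [ord, valuation_eq_one (RatFunc F) v hx, WithZero.log_one, neg_zero]

theorem ord_nonneg {x : RatFunc F} (hx : v.valuation (RatFunc F) x ≤ 1) : 0 ≤ ord v x := by
  by_cases h0 : v.valuation (RatFunc F) x = 0
  · simp [ord, h0]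
  · have := (WithZero.log_le_iff_le_exp h0 (a := 0)).2 (by simpa using hx)
    unfold ord; omega

theorem valuation_le_one_of_ord {x : RatFunc F} (hx : 0 ≤ ord v x) : v.valuation (RatFunc F) x ≤ 1 := by
  have h : WithZero.log (v.valuation (RatFunc F) x) ≤ 0 := by unfold ord at hx; omega
  by_cases h0 : v.valuation (RatFunc F) x = 0
  · rw [h0]; exact zero_le
  · simpa using (WithZero.log_le_iff_le_exp h0).1 h

theorem ord_algebraMap_nonneg (x : F[X]) : 0 ≤ ord v (algebraMap F[X] (RatFunc F) x) :=
  ord_nonneg v (v.valuation_le_one x)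

theorem ord_eq_one {x : F[X]} (hx : Squarefree x) (hxv : x ∈ v.asIdeal) :
    ord v (algebraMap F[X] (RatFunc F) x) = 1 := by
  obtain ⟨π, hπ, -⟩ := exists_generator v
  obtain ⟨s, hs, rfl⟩ := exists_eq_generator_mul v hπ hx hxv
  have := neg_log_valuation_pow_mul v hπ 1 (valuation_eq_one (RatFunc F) v hs)
  rw [pow_one] at this
  rw [ord, map_mul, this, Nat.cast_one]

theorem count_span_eq_ord {x : F[X]} (hx : x ≠ 0) :
    FractionalIdeal.count (RatFunc F) v
      ((Ideal.span {x} : Ideal F[X]) : FractionalIdeal F[X]⁰ (RatFunc F))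
      = ord v (algebraMap F[X] (RatFunc F) x) := count_span_singleton (RatFunc F) v hx

theorem exists_eq_pow_mul {π x : F[X]} (hπ : v.asIdeal = Ideal.span {π}) (hπ' : Irreducible π)
    (hx : x ≠ 0) : ∃ n : ℕ, ∃ u ∉ v.asIdeal, x = π ^ n * u ∧
      ord v (algebraMap F[X] (RatFunc F) x) = n := by
  obtain ⟨n, u, hu, rfl⟩ := WfDvdMonoid.max_power_factor hx hπ'
  have hu' : u ∉ v.asIdeal := by rwa [hπ, Ideal.mem_span_singleton]
  refine ⟨n, u, hu', rfl, ?_⟩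
  rw [ord, map_mul, map_pow]
  exact neg_log_valuation_pow_mul v hπ n (valuation_eq_one (RatFunc F) v hu')

theorem eventually_notMem {x : F[X]} (hx : x ≠ 0) :
    ∀ᶠ v : HeightOneSpectrum F[X] in Filter.cofinite, x ∉ v.asIdeal := by
  refine (Ideal.finite_factors (I := Ideal.span {x}) (by simpa using hx)).subset fun v hv => ?_
  have hv : x ∈ v.asIdeal := by simpa using hv
  exact Ideal.dvd_iff_le.2 ((Ideal.span_singleton_le_iff_mem _).2 hv)

end Polynomials

/-! ### The quadratic resolvent as an Artin–Schreier extension -/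

section Resolvent

variable {F : Type*} [Field F] {Q : Type*} [Field Q] [Algebra F[X] Q] [Algebra (RatFunc F) Q]
  [IsScalarTower F[X] (RatFunc F) Q] (v : HeightOneSpectrum F[X])

theorem finiteDimensional_of_artinSchreier {K Q : Type*} [Field K] [Field Q] [Algebra K Q] {z : Q} {b : K}
    (hz : z ^ 2 - z = algebraMap K Q b) (htop : IntermediateField.adjoin K {z} = ⊤) :
    FiniteDimensional K Q := by
  have hi : IsIntegral K z := ⟨X ^ 2 - X - C b, by monicity!, by simp [hz]⟩
  have := IntermediateField.adjoin.finiteDimensional hi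
  rw [htop] at this
  exact (IntermediateField.topEquiv (F := K) (E := Q)).toLinearEquiv.finiteDimensional

theorem isSeparable_of_artinSchreier {K Q : Type*} [Field K] [Field Q] [Algebra K Q] (h2 : (2 : K) = 0)
    {z : Q} {b : K}
    (hz : z ^ 2 - z = algebraMap K Q b) (htop : IntermediateField.adjoin K {z} = ⊤) :
    Algebra.IsSeparable K Q := by
  have hs : IsSeparable K z := by
    refine Separable.of_dvd (f := X ^ 2 - X - C b) ?_ (minpoly.dvd K z (by simp [hz]))
    have hd : derivative (X ^ 2 - X - C b) = -1 := by
      rw [derivative_sub, derivative_sub, derivative_C, derivative_X, derivative_X_pow, Nat.cast_ofNat, h2,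
        map_zero, zero_mul, zero_sub, sub_zero]
    rw [Separable, hd]
    exact isCoprime_one_right.neg_right
  have := (IntermediateField.isSeparable_adjoin_simple_iff_isSeparable K Q).2 hs
  rw [htop] at this
  exact Algebra.IsSeparable.of_algHom K (⊤ : IntermediateField K Q)
    (IntermediateField.topEquiv (F := K) (E := Q)).symm.toAlgHom

theorem not_ramifies_of_artinSchreier (h2 : (2 : RatFunc F) = 0) {z : Q} {b : RatFunc F}
    (hz : z ^ 2 - z = algebraMap (RatFunc F) Q b)
    (htop : IntermediateField.adjoin (RatFunc F) {z} = ⊤)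
    (hb : v.valuation (RatFunc F) b ≤ 1) : ¬ Ramifies v Q := by
  have := finiteDimensional_of_artinSchreier hz htop
  have := isSeparable_of_artinSchreier h2 hz htop
  have : Module.Finite F[X] (integralClosure F[X] Q) :=
    IsIntegralClosure.finite F[X] (RatFunc F) Q (integralClosure F[X] Q)
  have : IsDedekindDomain (integralClosure F[X] Q) :=
    integralClosure.isDedekindDomain F[X] (RatFunc F) Q
  have : FaithfulSMul F[X] Q := FaithfulSMul.trans F[X] (RatFunc F) Q
  rintro ⟨P, hP, hPv, h⟩
  exact h.not_ge (ramificationIdx_le_one_of_artinSchreier (RatFunc F) Q (integralClosure F[X] Q) v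
    h2 hz htop hb P)

theorem ramifies_of_artinSchreier (h2 : (2 : RatFunc F) = 0) {z : Q} {b : RatFunc F}
    (hz : z ^ 2 - z = algebraMap (RatFunc F) Q b)
    (htop : IntermediateField.adjoin (RatFunc F) {z} = ⊤)
    (hb : 1 < v.valuation (RatFunc F) b)
    (hodd : Odd (WithZero.log (v.valuation (RatFunc F) b))) : Ramifies v Q := by
  have := finiteDimensional_of_artinSchreier hz htop
  have := isSeparable_of_artinSchreier h2 hz htop
  have : Module.Finite F[X] (integralClosure F[X] Q) :=
    IsIntegralClosure.finite F[X] (RatFunc F) Q (integralClosure F[X] Q)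
  have : IsDedekindDomain (integralClosure F[X] Q) :=
    integralClosure.isDedekindDomain F[X] (RatFunc F) Q
  have : FaithfulSMul F[X] Q := FaithfulSMul.trans F[X] (RatFunc F) Q
  exact exists_one_lt_ramificationIdx_of_artinSchreier (RatFunc F) Q (integralClosure F[X] Q) v
    hz hb hodd

theorem adjoin_eq_top_of_mem {K Q : Type*} [Field K] [Field Q] [Algebra K Q] {r z : Q}
    (hr : IntermediateField.adjoin K {r} = ⊤) (h : r ∈ IntermediateField.adjoin K {z}) :
    IntermediateField.adjoin K {z} = ⊤ := by
  rw [eq_top_iff, ← hr, IntermediateField.adjoin_simple_le_iff]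
  exact h

/-- In characteristic two the resolvent is X² + aX + a² + 1. Dividing by a² makes r/a an
Artin–Schreier root for 1/a² + 1, and adding η changes the parameter by η² − η. -/
theorem artinSchreier_of_resolvent {K Q : Type*} [Field K] [Field Q] [Algebra K Q] (h2 : (2 : K) = 0)
    {a : K} (ha : a ≠ 0) {r : Q} (hr : aeval r (quadraticResolvent (X ^ 3 - 3 * X - C a : K[X])) = 0)
    (htop : IntermediateField.adjoin K {r} = ⊤) (η : K) :
    (r / algebraMap K Q a + algebraMap K Q η) ^ 2 - (r / algebraMap K Q a + algebraMap K Q η)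
      = algebraMap K Q (1 / a ^ 2 + 1 + η ^ 2 - η) ∧
    IntermediateField.adjoin K {r / algebraMap K Q a + algebraMap K Q η} = ⊤ := by
  have haQ : algebraMap K Q a ≠ 0 := by simpa using ha
  constructor
  · have c0 : (X ^ 3 - 3 * X - C a : K[X]).coeff 0 = -a := by simp [coeff_X]
    have c1 : (X ^ 3 - 3 * X - C a : K[X]).coeff 1 = -3 := by
      simp [coeff_X_pow]
    have c2 : (X ^ 3 - 3 * X - C a : K[X]).coeff 2 = 0 := by
      simp [coeff_X_pow, coeff_X]
    have h2Q : (2 : Q) = 0 := by rw [← map_ofNat (algebraMap K Q), h2, map_zero]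
    simp only [quadraticResolvent, c0, c1, c2] at hr
    simp at hr
    simp only [map_sub, map_add, map_div₀, map_pow, map_one]
    field_simp
    have h9 : algebraMap K Q 3 = 3 := map_ofNat _ 3
    have h9' : algebraMap K Q 9 = 9 := map_ofNat _ 9
    rw [h9, h9'] at hr
    generalize algebraMap K Q a = a' at *
    generalize algebraMap K Q η = η' at *
    linear_combination hr + (r * η' * a' - 2 * r * a' - 5 * a' ^ 2 + 13) * h2Q
  · refine adjoin_eq_top_of_mem htop ?_
    set z := r / algebraMap K Q a + algebraMap K Q η with hz
    have : r = (z - algebraMap K Q η) * algebraMap K Q a := by rw [hz]; field_simp; ring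
    rw [this]
    exact mul_mem (sub_mem (IntermediateField.mem_adjoin_simple_self K z)
      (IntermediateField.algebraMap_mem _ _)) (IntermediateField.algebraMap_mem _ _)

end Resolvent
end

/-! ### The discriminant of ω and the orders of ∂ over `F[x]` -/

section

variable {F : Type*} [Field F] {L : Type*} [Field L] [Algebra F[X] L] [Algebra (RatFunc F) L]
  [IsScalarTower F[X] (RatFunc F) L] [FiniteDimensional (RatFunc F) L]
  [Algebra.IsSeparable (RatFunc F) L]

theorem discriminantIdeal_ne_zero : discriminantIdeal F L ≠ 0 := by
  have : Module.Finite F[X] (integralClosure F[X] L) :=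
    IsIntegralClosure.finite F[X] (RatFunc F) L (integralClosure F[X] L)
  have : IsDedekindDomain (integralClosure F[X] L) :=
    integralClosure.isDedekindDomain F[X] (RatFunc F) L
  have : FaithfulSMul F[X] L := FaithfulSMul.trans F[X] (RatFunc F) L
  have := integralClosure.isFractionRing_of_finite_extension (A := F[X]) (RatFunc F) L
  rw [discriminantIdeal, Ne, Ideal.zero_eq_bot, Ideal.relNorm_eq_bot_iff,
    ← FractionalIdeal.coeIdeal_inj (K := L), coeIdeal_differentIdeal F[X] (RatFunc F)]
  simp

namespace IsNormalForm

variable {a : RatFunc F} {α β₁ β₂ γ : F[X]} (H : IsNormalForm a α β₁ β₂ γ) {y : L}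
  (hy : y ^ 3 - 3 * y - algebraMap (RatFunc F) L a = 0)
include H hy

omit [FiniteDimensional (RatFunc F) L] [Algebra.IsSeparable (RatFunc F) L] in
theorem gen_cubic_polynomial :
    (algebraMap F[X] L (γ * β₁ * β₂) * y) ^ 3
      + algebraMap F[X] L 0 * (algebraMap F[X] L (γ * β₁ * β₂) * y) ^ 2
      + algebraMap F[X] L (-3 * (γ * β₁ * β₂) ^ 2) * (algebraMap F[X] L (γ * β₁ * β₂) * y)
      + algebraMap F[X] L (-(β₁ ^ 2 * β₂ * α)) = 0 := by
  simpa only [← IsScalarTower.algebraMap_apply] using H.gen_cubic L hy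

omit [FiniteDimensional (RatFunc F) L] [Algebra.IsSeparable (RatFunc F) L] in
theorem isIntegral_gen : IsIntegral F[X] (algebraMap F[X] L (γ * β₁ * β₂) * y) := by
  have h := H.gen_cubic_polynomial hy
  refine ⟨X ^ 3 + C 0 * X ^ 2 + C (-3 * (γ * β₁ * β₂) ^ 2) * X + C (-(β₁ ^ 2 * β₂ * α)),
    by monicity!, ?_⟩
  rw [← h]
  simp only [eval₂_add, eval₂_mul, eval₂_pow, eval₂_X, eval₂_C]

variable (h3 : Module.finrank (RatFunc F) L = 3)
  (hyK : y ∉ Set.range (algebraMap (RatFunc F) L))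
include h3 hyK

omit [FiniteDimensional (RatFunc F) L] [Algebra.IsSeparable (RatFunc F) L] in
theorem elementDiscr_gen : elementDiscr F (algebraMap F[X] L (γ * β₁ * β₂) * y)
    = 27 * β₁ ^ 4 * β₂ ^ 2 * (4 * γ ^ 6 * (β₁ * β₂ ^ 2) ^ 2 - α ^ 2) := by
  have hm : minpoly F[X] (algebraMap F[X] L (γ * β₁ * β₂) * y)
      = X ^ 3 + C 0 * X ^ 2 + C (-3 * (γ * β₁ * β₂) ^ 2) * X + C (-(β₁ ^ 2 * β₂ * α)) := by
    refine Polynomial.map_injective _ (IsFractionRing.injective F[X] (RatFunc F)) ?_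
    rw [← minpoly.isIntegrallyClosed_eq_field_fractions' (RatFunc F) (H.isIntegral_gen hy),
      minpoly_eq_cubic h3 (H.gen_notMem_range L h3 hyK) (H.gen_cubic L hy)]
    simp only [Polynomial.map_add, Polynomial.map_mul, Polynomial.map_pow, map_X, map_C]
  rw [elementDiscr, hm, cubicDiscr]
  have e : ∀ c d : F[X],
      ((X ^ 3 + C 0 * X ^ 2 + C c * X + C d : F[X][X]).coeff 0 = d) ∧
      ((X ^ 3 + C 0 * X ^ 2 + C c * X + C d : F[X][X]).coeff 1 = c) ∧
      ((X ^ 3 + C 0 * X ^ 2 + C c * X + C d : F[X][X]).coeff 2 = 0) := by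
    intro c d
    refine ⟨?_, ?_, ?_⟩ <;> simp [coeff_X, coeff_X_pow, coeff_C]
  rw [(e _ _).1, (e _ _).2.1, (e _ _).2.2]
  ring

omit [FiniteDimensional (RatFunc F) L] in
theorem discrFactor_ne_zero :
    4 * γ ^ 6 * (β₁ * β₂ ^ 2) ^ 2 - α ^ 2 ≠ 0 := by
  intro h0
  refine disc3_ne_zero_of_isSeparable h3 (H.gen_notMem_range L h3 hyK) (H.gen_cubic L hy) ?_
  have := congrArg (fun x => algebraMap F[X] (RatFunc F) (27 * β₁ ^ 4 * β₂ ^ 2 * x)) h0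
  simp only [map_mul, map_sub, map_pow, map_zero, mul_zero, map_ofNat] at this
  rw [← this]
  simp only [disc3, map_mul, map_neg, map_pow, map_zero, map_ofNat]
  ring

section count

variable (v : HeightOneSpectrum F[X]) (hF3 : (3 : F) ≠ 0)
include hF3

theorem count_discriminantIdeal_of_notMem
    (hD : β₁ ∈ v.asIdeal ∨ β₂ ∈ v.asIdeal ∨ 4 * γ ^ 6 * (β₁ * β₂ ^ 2) ^ 2 - α ^ 2 ∉ v.asIdeal) :
    FractionalIdeal.count (RatFunc F) v
        (discriminantIdeal F L : FractionalIdeal F[X]⁰ (RatFunc F))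
      = 2 * ord v (algebraMap F[X] (RatFunc F) β₁) + 2 * ord v (algebraMap F[X] (RatFunc F) β₂) := by
  have : Module.Finite F[X] (integralClosure F[X] L) :=
    IsIntegralClosure.finite F[X] (RatFunc F) L (integralClosure F[X] L)
  have : IsDedekindDomain (integralClosure F[X] L) :=
    integralClosure.isDedekindDomain F[X] (RatFunc F) L
  have : FaithfulSMul F[X] L := FaithfulSMul.trans F[X] (RatFunc F) L
  obtain ⟨π, hπ, -⟩ := exists_generator v
  have hv3 : v.valuation (RatFunc F) 3 = 1 := by
    simpa using valuation_natCast_eq_one v 3 (by simpa using hF3)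
  by_cases h1 : β₁ ∈ v.asIdeal
  · rw [ord_eq_one v H.squarefree_left h1, ord_eq_zero v (H.right_notMem hπ h1)]
    exact H.count_of_left_mem L (integralClosure F[X] L) hy hπ h3 hyK hv3 h1
  by_cases h2 : β₂ ∈ v.asIdeal
  · rw [ord_eq_one v H.squarefree_right h2, ord_eq_zero v h1]
    exact H.count_of_right_mem L (integralClosure F[X] L) hy hπ h3 hyK hv3 h2
  · rw [ord_eq_zero v h1, ord_eq_zero v h2]
    exact H.count_of_notMem L (integralClosure F[X] L) hy h3 hyK hv3 h1 h2
      ((hD.resolve_left h1).resolve_left h2)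

theorem count_discriminantIdeal_of_two_ne_zero (hF2 : (2 : F) ≠ 0) :
    FractionalIdeal.count (RatFunc F) v
        (discriminantIdeal F L : FractionalIdeal F[X]⁰ (RatFunc F))
      = 2 * ord v (algebraMap F[X] (RatFunc F) β₁) + 2 * ord v (algebraMap F[X] (RatFunc F) β₂)
        + ord v (algebraMap F[X] (RatFunc F) (4 * γ ^ 6 * (β₁ * β₂ ^ 2) ^ 2 - α ^ 2)) % 2 := by
  by_cases hD : 4 * γ ^ 6 * (β₁ * β₂ ^ 2) ^ 2 - α ^ 2 ∈ v.asIdeal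
  swap
  · rw [H.count_discriminantIdeal_of_notMem hy h3 hyK v hF3 (Or.inr (Or.inr hD)), ord_eq_zero v hD]
    simp
  have : Module.Finite F[X] (integralClosure F[X] L) :=
    IsIntegralClosure.finite F[X] (RatFunc F) L (integralClosure F[X] L)
  have : IsDedekindDomain (integralClosure F[X] L) :=
    integralClosure.isDedekindDomain F[X] (RatFunc F) L
  have : FaithfulSMul F[X] L := FaithfulSMul.trans F[X] (RatFunc F) L
  obtain ⟨π, hπ, hπ'⟩ := exists_generator v
  have hv3 : v.valuation (RatFunc F) 3 = 1 := by
    simpa using valuation_natCast_eq_one v 3 (by simpa using hF3)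
  have hv2 : v.valuation (RatFunc F) 2 = 1 := by
    simpa using valuation_natCast_eq_one v 2 (by simpa using hF2)
  obtain ⟨h1, h2, -, -⟩ := H.notMem_of_discrFactor_mem hv2 hD
  obtain ⟨n, u, hu, hnu, hn⟩ := exists_eq_pow_mul v hπ hπ' (H.discrFactor_ne_zero hy h3 hyK)
  rw [ord_eq_zero v h1, ord_eq_zero v h2, hn]
  have hn0 : n ≠ 0 := by
    rintro rfl
    rw [pow_zero, one_mul] at hnu
    exact hu (hnu ▸ hD)
  have := H.count_of_discrFactor L (integralClosure F[X] L) hy hπ h3 hyK hv3 hv2 hn0 hu hnu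
  rw [discriminantIdeal, this]
  simp

end count

section charTwo

variable (v : HeightOneSpectrum F[X]) (hF2 : (2 : F) = 0) {η b : RatFunc F}
  (hb : b = 1 / a ^ 2 + 1 + η ^ 2 - η)
include hF2 hb

theorem count_discriminantIdeal_of_valuation_le_one
    (hbv : α ∈ v.asIdeal → v.valuation (RatFunc F) b ≤ 1) :
    FractionalIdeal.count (RatFunc F) v
        (discriminantIdeal F L : FractionalIdeal F[X]⁰ (RatFunc F))
      = 2 * ord v (algebraMap F[X] (RatFunc F) β₁)
        + 2 * ord v (algebraMap F[X] (RatFunc F) β₂) := by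
  have hF3 : (3 : F) ≠ 0 := fun h => one_ne_zero (α := F) (by linear_combination h - hF2)
  have h2K : (2 : RatFunc F) = 0 := by
    rw [← map_ofNat (algebraMap F (RatFunc F)), hF2, map_zero]
  by_cases hα : α ∈ v.asIdeal
  swap
  · refine H.count_discriminantIdeal_of_notMem hy h3 hyK v hF3 (Or.inr (Or.inr fun h => hα ?_))
    have h2A : (2 : F[X]) = 0 := by rw [← map_ofNat C, hF2, map_zero]
    refine v.isPrime.mem_of_pow_mem 2 ?_
    convert neg_mem h using 1
    linear_combination (2 * γ ^ 6 * (β₁ * β₂ ^ 2) ^ 2) * h2A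
  have : Module.Finite F[X] (integralClosure F[X] L) :=
    IsIntegralClosure.finite F[X] (RatFunc F) L (integralClosure F[X] L)
  have : IsDedekindDomain (integralClosure F[X] L) :=
    integralClosure.isDedekindDomain F[X] (RatFunc F) L
  have : FaithfulSMul F[X] L := FaithfulSMul.trans F[X] (RatFunc F) L
  obtain ⟨h1, h2, -⟩ := H.notMem_of_mem hα
  rw [ord_eq_zero v h1, ord_eq_zero v h2]
  exact H.count_eq_zero_of_charTwo L (integralClosure F[X] L) hy h3 hyK h2K hα hb (hbv hα)

theorem count_discriminantIdeal_of_one_lt_valuation (hα : α ∈ v.asIdeal)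
    (hbv : 1 < v.valuation (RatFunc F) b) (hodd : Odd (ord v b)) :
    FractionalIdeal.count (RatFunc F) v
        (discriminantIdeal F L : FractionalIdeal F[X]⁰ (RatFunc F))
      = 2 * ord v (algebraMap F[X] (RatFunc F) β₁)
        + 2 * ord v (algebraMap F[X] (RatFunc F) β₂) + (-ord v b + 1) ∧
      -ord v b < 2 * ord v (algebraMap F[X] (RatFunc F) α) := by
  have h2K : (2 : RatFunc F) = 0 := by
    rw [← map_ofNat (algebraMap F (RatFunc F)), hF2, map_zero]
  have : Module.Finite F[X] (integralClosure F[X] L) :=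
    IsIntegralClosure.finite F[X] (RatFunc F) L (integralClosure F[X] L)
  have : IsDedekindDomain (integralClosure F[X] L) :=
    integralClosure.isDedekindDomain F[X] (RatFunc F) L
  have : FaithfulSMul F[X] L := FaithfulSMul.trans F[X] (RatFunc F) L
  obtain ⟨π, hπ, -⟩ := exists_generator v
  obtain ⟨h1, h2, -⟩ := H.notMem_of_mem hα
  obtain ⟨e, e'⟩ := H.count_of_charTwo L (integralClosure F[X] L) hy hπ h3 hyK h2K hα hb hbv
    (by simpa [ord] using hodd)
  rw [ord_eq_zero v h1, ord_eq_zero v h2, discriminantIdeal, e]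
  simp only [ord]
  exact ⟨by ring, by linarith⟩

end charTwo

end IsNormalForm

end

/-! ### Global formulas for ∂ and Ind(ω) -/

section

theorem notMem_range_of_adjoin_eq_top {K L : Type*} [Field K] [Field L] [Algebra K L]
    (h3 : Module.finrank K L = 3) {y : L} (hy : IntermediateField.adjoin K {y} = ⊤) :
    y ∉ Set.range (algebraMap K L) := by
  intro h
  have h1 : IntermediateField.adjoin K {y} = ⊥ :=
    IntermediateField.adjoin_simple_eq_bot_iff.2 (IntermediateField.mem_bot.2 h)
  have h2 : Module.finrank K (⊤ : IntermediateField K L) = 3 := by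
    rw [IntermediateField.finrank_top', h3]
  rw [← hy, h1, IntermediateField.finrank_bot] at h2
  omega

namespace IsNormalForm

variable {F : Type*} [Field F] {a : RatFunc F} {α β₁ β₂ γ : F[X]}
  (H : IsNormalForm a α β₁ β₂ γ)

section Cubic

variable {L : Type*} [Field L] [Algebra F[X] L]
  [Algebra (RatFunc F) L] [IsScalarTower F[X] (RatFunc F) L] [FiniteDimensional (RatFunc F) L]
  [Algebra.IsSeparable (RatFunc F) L] {y : L}
  (hy : y ^ 3 - 3 * y - algebraMap (RatFunc F) L a = 0)
  (h3 : Module.finrank (RatFunc F) L = 3) (hyK : y ∉ Set.range (algebraMap (RatFunc F) L))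
include H hy h3 hyK

/-- Since 27 is a unit, the left side of the hypothesis is the order of Δ(ω); unique factorization
then leaves `J` as the only possible index. -/
theorem isInd_iff (hF3 : (3 : F) ≠ 0) {J : Ideal F[X]} (hJ : J ≠ 0)
    (h : ∀ v, 4 * ord v (algebraMap F[X] (RatFunc F) β₁) + 2 * ord v (algebraMap F[X] (RatFunc F) β₂)
        + ord v (algebraMap F[X] (RatFunc F) (4 * γ ^ 6 * (β₁ * β₂ ^ 2) ^ 2 - α ^ 2))
      = 2 * FractionalIdeal.count (RatFunc F) v (J : FractionalIdeal F[X]⁰ (RatFunc F))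
        + FractionalIdeal.count (RatFunc F) v
          (discriminantIdeal F L : FractionalIdeal F[X]⁰ (RatFunc F))) (I : Ideal F[X]) :
    IsInd (algebraMap F[X] L (γ * β₁ * β₂) * y) I ↔ I = J := by
  have hD := H.discrFactor_ne_zero hy h3 hyK
  have hu : IsUnit (27 : F[X]) := by
    have : (27 : F) ≠ 0 := by
      rw [show (27 : F) = 3 ^ 3 by norm_num]
      exact pow_ne_zero 3 hF3
    rw [← map_ofNat C]
    exact isUnit_C.2 (isUnit_iff_ne_zero.2 this)
  have hne : 27 * β₁ ^ 4 * β₂ ^ 2 * (4 * γ ^ 6 * (β₁ * β₂ ^ 2) ^ 2 - α ^ 2) ≠ 0 :=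
    _root_.mul_ne_zero (_root_.mul_ne_zero (_root_.mul_ne_zero hu.ne_zero
      (pow_ne_zero 4 H.left_ne_zero)) (pow_ne_zero 2 H.right_ne_zero)) hD
  rw [IsInd, H.elementDiscr_gen hy h3 hyK]
  refine eq_sq_mul_iff_of_count (RatFunc F) (by simpa using hne) discriminantIdeal_ne_zero hJ
    (fun v => ?_) I
  rw [count_span_eq_ord v hne, ← h v]
  have hinj : ∀ {x : F[X]}, x ≠ 0 → algebraMap F[X] (RatFunc F) x ≠ 0 := fun hx =>
    (map_ne_zero_iff _ (IsFractionRing.injective F[X] (RatFunc F))).2 hx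
  have hb₁ := hinj H.left_ne_zero
  have hb₂ := hinj H.right_ne_zero
  have h27 := hinj hu.ne_zero
  rw [map_mul, map_mul, map_mul, map_pow _ β₁, map_pow _ β₂, ord_mul v
    (_root_.mul_ne_zero (_root_.mul_ne_zero h27 (pow_ne_zero _ hb₁)) (pow_ne_zero _ hb₂)) (hinj hD),
    ord_mul v (_root_.mul_ne_zero h27 (pow_ne_zero _ hb₁)) (pow_ne_zero _ hb₂),
    ord_mul v h27 (pow_ne_zero _ hb₁), ord_pow, ord_pow, ord_eq_zero v (isUnit_notMem v hu)]
  push_cast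
  ring

theorem discriminantIdeal_and_isInd_of_two_ne_zero (hF3 : (3 : F) ≠ 0) (hF2 : (2 : F) ≠ 0)
    {η₁ η₂ : F[X]} (hη₁ : Squarefree η₁)
    (hη : 4 * γ ^ 6 * (β₁ * β₂ ^ 2) ^ 2 - α ^ 2 = η₁ * η₂ ^ 2) :
    discriminantIdeal F L = Ideal.span {(β₁ * β₂) ^ 2 * η₁} ∧
    ∀ I : Ideal F[X], IsInd (algebraMap F[X] L (γ * β₁ * β₂) * y) I
      ↔ I = Ideal.span {β₁ * η₂} := by
  have hinj : ∀ {x : F[X]}, x ≠ 0 → algebraMap F[X] (RatFunc F) x ≠ 0 := fun hx =>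
    (map_ne_zero_iff _ (IsFractionRing.injective F[X] (RatFunc F))).2 hx
  have hD := H.discrFactor_ne_zero hy h3 hyK
  have h₁ := H.left_ne_zero
  have h₂ := H.right_ne_zero
  have hη₁0 : η₁ ≠ 0 := hη₁.ne_zero
  have hη₂0 : η₂ ≠ 0 := by
    rintro rfl
    exact hD (by rw [hη]; ring)
  have hord : ∀ v, ord v (algebraMap F[X] (RatFunc F) (4 * γ ^ 6 * (β₁ * β₂ ^ 2) ^ 2 - α ^ 2))
      = ord v (algebraMap F[X] (RatFunc F) η₁) + 2 * ord v (algebraMap F[X] (RatFunc F) η₂) := by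
    intro v
    rw [hη, map_mul, map_pow, ord_mul v (hinj hη₁0) (pow_ne_zero 2 (hinj hη₂0)), ord_pow]
    norm_num
  -- A square-free η₁ has order 0 or 1, so it is recovered from the parity of the order of D.
  have hmod : ∀ v, (ord v (algebraMap F[X] (RatFunc F) η₁)
      + 2 * ord v (algebraMap F[X] (RatFunc F) η₂)) % 2 = ord v (algebraMap F[X] (RatFunc F) η₁) := by
    intro v
    by_cases h : η₁ ∈ v.asIdeal
    · rw [ord_eq_one v hη₁ h]; omega
    · rw [ord_eq_zero v h]; omega
  have hcount : ∀ v, FractionalIdeal.count (RatFunc F) v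
        (discriminantIdeal F L : FractionalIdeal F[X]⁰ (RatFunc F))
      = 2 * ord v (algebraMap F[X] (RatFunc F) β₁) + 2 * ord v (algebraMap F[X] (RatFunc F) β₂)
        + ord v (algebraMap F[X] (RatFunc F) η₁) := by
    intro v
    rw [H.count_discriminantIdeal_of_two_ne_zero hy h3 hyK v hF3 hF2, hord, hmod]
  have hne : (β₁ * β₂) ^ 2 * η₁ ≠ 0 :=
    _root_.mul_ne_zero (pow_ne_zero 2 (_root_.mul_ne_zero h₁ h₂)) hη₁0
  have hne' : β₁ * η₂ ≠ 0 := _root_.mul_ne_zero h₁ hη₂0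
  refine ⟨eq_of_count_coeIdeal_eq (RatFunc F) discriminantIdeal_ne_zero (by simpa using hne)
    fun v => ?_, H.isInd_iff hy h3 hyK hF3 (by simpa using hne') fun v => ?_⟩
  · rw [hcount, count_span_eq_ord v hne, map_mul, map_pow, map_mul, ord_mul v
      (pow_ne_zero 2 (_root_.mul_ne_zero (hinj h₁) (hinj h₂))) (hinj hη₁0), ord_pow,
      ord_mul v (hinj h₁) (hinj h₂)]
    push_cast
    ring
  · rw [hcount, hord, count_span_eq_ord v hne', map_mul, ord_mul v (hinj h₁) (hinj hη₂0)]
    ring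

end Cubic

section CharTwo

variable {Q : Type*} [Field Q] [Algebra F[X] Q] [Algebra (RatFunc F) Q]
  [IsScalarTower F[X] (RatFunc F) Q] (hα : α ≠ 0) (hF2 : (2 : F) = 0) {r : Q}
  (hr : aeval r (quadraticResolvent (X ^ 3 - 3 * X - C a : (RatFunc F)[X])) = 0)
  (htop : IntermediateField.adjoin (RatFunc F) {r} = ⊤)
include H hα hF2 hr htop

/-- Where α does not vanish, 1/a is integral, so the parameter 1/a² + 1 obtained with η = 0 already
shows that v is unramified. -/
theorem mem_of_ramifies (v : HeightOneSpectrum F[X]) (hv : Ramifies v Q) : α ∈ v.asIdeal := by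
  by_contra hαv
  have h2K : (2 : RatFunc F) = 0 := by
    rw [← map_ofNat (algebraMap F (RatFunc F)), hF2, map_zero]
  obtain ⟨e, e'⟩ := artinSchreier_of_resolvent h2K (H.param_ne_zero hα) hr htop 0
  refine not_ramifies_of_artinSchreier v h2K e e' ?_ hv
  have hva : v.valuation (RatFunc F) (1 / a) ≤ 1 := by
    have h1 : v.valuation (RatFunc F) a * v.valuation (RatFunc F)
        (algebraMap F[X] (RatFunc F) (γ ^ 3 * (β₁ * β₂ ^ 2))) = 1 := by
      rw [← map_mul, H.eq, valuation_eq_one (RatFunc F) v hαv]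
    rw [one_div, map_inv₀, inv_eq_of_mul_eq_one_right h1]
    exact v.valuation_le_one _
  rw [show 1 / a ^ 2 + 1 + 0 ^ 2 - 0 = (1 / a) ^ 2 + 1 by ring]
  refine (Valuation.map_add _ _ _).trans (max_le ?_ (map_one _).le)
  rw [map_pow]
  exact pow_le_one₀ zero_le hva

theorem exists_isGlobalStandardForm [Finite F] :
    ∃ (η : RatFunc F) (z : Q), IsGlobalStandardForm a α η z := by
  have h2K : (2 : RatFunc F) = 0 := by
    rw [← map_ofNat (algebraMap F (RatFunc F)), hF2, map_zero]
  have : CharP F 2 := CharTwo.of_one_ne_zero_of_two_eq_zero one_ne_zero hF2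
  obtain ⟨η, hη⟩ := exists_artinSchreier_reduction (1 / a ^ 2 + 1)
  obtain ⟨e, e'⟩ := artinSchreier_of_resolvent h2K (H.param_ne_zero hα) hr htop η
  refine ⟨η, _, e', e, fun v hv => ?_, fun v hv hv' => ?_⟩
  · have h1 : ¬ v.valuation (RatFunc F) (asFun a η) ≤ 1 := fun h =>
      not_ramifies_of_artinSchreier v h2K e e' h hv
    have h2 := (hη v).2.resolve_left h1
    refine ⟨?_, h2.neg⟩
    by_contra! h
    exact h1 (valuation_le_one_of_ord v h)
  · rcases (hη v).2 with h | h
    · exact ord_nonneg v h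
    · by_contra! h'
      refine hv' (ramifies_of_artinSchreier v h2K e e' ?_ h)
      by_contra! h''
      exact h'.not_ge (ord_nonneg v h'')

variable {L : Type*} [Field L] [Algebra F[X] L]
  [Algebra (RatFunc F) L] [IsScalarTower F[X] (RatFunc F) L] [FiniteDimensional (RatFunc F) L]
  [Algebra.IsSeparable (RatFunc F) L] {y : L}
  (hy : y ^ 3 - 3 * y - algebraMap (RatFunc F) L a = 0)
  (h3 : Module.finrank (RatFunc F) L = 3) (hyK : y ∉ Set.range (algebraMap (RatFunc F) L))
  {η : RatFunc F} {z : Q} (G : IsGlobalStandardForm a α η z)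
include hy h3 hyK G

/-- Evenness and the upper bound on ℓ + 1 make v(α) − (ℓ + 1)/2 a nonnegative integer at the places
dividing α. -/
theorem count_discriminantIdeal_of_two_eq_zero (v : HeightOneSpectrum F[X]) :
    FractionalIdeal.count (RatFunc F) v
        (discriminantIdeal F L : FractionalIdeal F[X]⁰ (RatFunc F))
      = 2 * ord v (algebraMap F[X] (RatFunc F) β₁) + 2 * ord v (algebraMap F[X] (RatFunc F) β₂)
        + (ell v Q (asFun a η) + 1) ∧
    0 ≤ ell v Q (asFun a η) + 1 ∧ Even (ell v Q (asFun a η) + 1) ∧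
    (α ∈ v.asIdeal → ell v Q (asFun a η) + 1 ≤ 2 * ord v (algebraMap F[X] (RatFunc F) α)) := by
  by_cases hv : Ramifies v Q
  · obtain ⟨hneg, hodd⟩ := G.ramified v hv
    have hαv := H.mem_of_ramifies hα hF2 hr htop v hv
    obtain ⟨e, e'⟩ := H.count_discriminantIdeal_of_one_lt_valuation hy h3 hyK v hF2 rfl hαv
      (b := asFun a η) (by
        by_contra! h
        exact hneg.not_ge (ord_nonneg v h)) hodd
    rw [ell, if_pos hv]
    exact ⟨e, by omega, hodd.neg.add_one, fun _ => by omega⟩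
  · rw [ell, if_neg hv, H.count_discriminantIdeal_of_valuation_le_one hy h3 hyK v hF2
      (b := asFun a η) rfl fun h => valuation_le_one_of_ord v (G.unramified v h hv)]
    refine ⟨by ring, by norm_num, by norm_num, fun _ => ?_⟩
    have := ord_algebraMap_nonneg v α
    omega

theorem discriminantIdeal_of_two_eq_zero :
    ((discriminantIdeal F L : Ideal F[X]) : FractionalIdeal F[X]⁰ (RatFunc F)) =
      ((Ideal.span {(β₁ * β₂) ^ 2} : Ideal F[X]) : FractionalIdeal F[X]⁰ (RatFunc F)) *
      ∏ᶠ (v : HeightOneSpectrum F[X]) (_ : ord v (asFun a η) < 0 ∧ Odd (ord v (asFun a η))),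
        (v.asIdeal : FractionalIdeal F[X]⁰ (RatFunc F)) ^ (ell v Q (asFun a η) + 1) := by
  have hinj : ∀ {x : F[X]}, x ≠ 0 → algebraMap F[X] (RatFunc F) x ≠ 0 := fun hx =>
    (map_ne_zero_iff _ (IsFractionRing.injective F[X] (RatFunc F))).2 hx
  have hell : ∀ v, ¬ Ramifies v Q → ell v Q (asFun a η) + 1 = 0 := fun v hv => by
    rw [ell, if_neg hv]; norm_num
  obtain ⟨hP, hPc⟩ := count_finprod_of_prop (RatFunc F)
    (fun v => ord v (asFun a η) < 0 ∧ Odd (ord v (asFun a η)))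
    (fun v => ell v Q (asFun a η) + 1) (by
      filter_upwards [eventually_notMem hα] with v hv _
      exact hell v fun h => hv (H.mem_of_ramifies hα hF2 hr htop v h))
  have hne : (β₁ * β₂) ^ 2 ≠ 0 :=
    pow_ne_zero 2 (_root_.mul_ne_zero H.left_ne_zero H.right_ne_zero)
  have hS : ((Ideal.span {(β₁ * β₂) ^ 2} : Ideal F[X]) : FractionalIdeal F[X]⁰ (RatFunc F)) ≠ 0 := by
    rw [FractionalIdeal.coeIdeal_ne_zero]
    simpa using hne
  refine eq_of_count_eq (FractionalIdeal.coeIdeal_ne_zero.2 discriminantIdeal_ne_zero)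
    (_root_.mul_ne_zero hS hP) fun v => ?_
  rw [FractionalIdeal.count_mul _ v hS hP, count_span_eq_ord v hne, map_pow, map_mul, ord_pow,
    ord_mul v (hinj H.left_ne_zero) (hinj H.right_ne_zero),
    (H.count_discriminantIdeal_of_two_eq_zero hα hF2 hr htop hy h3 hyK G v).1]
  have : FractionalIdeal.count (RatFunc F) v (∏ᶠ (v : HeightOneSpectrum F[X])
      (_ : ord v (asFun a η) < 0 ∧ Odd (ord v (asFun a η))),
        (v.asIdeal : FractionalIdeal F[X]⁰ (RatFunc F)) ^ (ell v Q (asFun a η) + 1))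
      = ell v Q (asFun a η) + 1 := by
    -- Ramified places satisfy the product condition, and the convention ℓ = −1 makes the exponent
    -- vanish at all others.
    by_cases hc : ord v (asFun a η) < 0 ∧ Odd (ord v (asFun a η))
    · exact (hPc v).1 hc
    · rw [(hPc v).2 hc, hell v fun h => hc (G.ramified v h)]
  rw [this]
  push_cast
  ring

theorem exists_isInd_of_two_eq_zero :
    ∃ I : Ideal F[X], (∀ J : Ideal F[X],
        IsInd (algebraMap F[X] L (γ * β₁ * β₂) * y) J ↔ J = I) ∧
      (I : FractionalIdeal F[X]⁰ (RatFunc F)) =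
        ((Ideal.span {β₁} : Ideal F[X]) : FractionalIdeal F[X]⁰ (RatFunc F)) *
        ∏ᶠ (v : HeightOneSpectrum F[X]) (_ : α ∈ v.asIdeal),
          (v.asIdeal : FractionalIdeal F[X]⁰ (RatFunc F)) ^
            (ord v (algebraMap F[X] (RatFunc F) α) - (ell v Q (asFun a η) + 1) / 2) := by
  have hF3 : (3 : F) ≠ 0 := fun h => one_ne_zero (α := F) (by linear_combination h - hF2)
  obtain ⟨hP, hPc⟩ := count_finprod_of_prop (RatFunc F) (fun v => α ∈ v.asIdeal)
    (fun v => ord v (algebraMap F[X] (RatFunc F) α) - (ell v Q (asFun a η) + 1) / 2) (by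
      filter_upwards [eventually_notMem hα] with v hv hv'
      exact absurd hv' hv)
  have hS : ((Ideal.span {β₁} : Ideal F[X]) : FractionalIdeal F[X]⁰ (RatFunc F)) ≠ 0 := by
    rw [FractionalIdeal.coeIdeal_ne_zero]
    simpa using H.left_ne_zero
  have key : ∀ v, FractionalIdeal.count (RatFunc F) v (∏ᶠ (v : HeightOneSpectrum F[X])
      (_ : α ∈ v.asIdeal), (v.asIdeal : FractionalIdeal F[X]⁰ (RatFunc F)) ^
        (ord v (algebraMap F[X] (RatFunc F) α) - (ell v Q (asFun a η) + 1) / 2))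
      = ord v (algebraMap F[X] (RatFunc F) α) - (ell v Q (asFun a η) + 1) / 2 := by
    intro v
    by_cases hv : α ∈ v.asIdeal
    · exact (hPc v).1 hv
    · rw [(hPc v).2 hv, ord_eq_zero v hv, ell,
        if_neg fun h => hv (H.mem_of_ramifies hα hF2 hr htop v h)]
      norm_num
  -- In characteristic two the first term disappears and signs do not matter.
  have hD : 4 * γ ^ 6 * (β₁ * β₂ ^ 2) ^ 2 - α ^ 2 = α ^ 2 := by
    have h2A : (2 : F[X]) = 0 := by rw [← map_ofNat C, hF2, map_zero]
    linear_combination (2 * γ ^ 6 * (β₁ * β₂ ^ 2) ^ 2 - α ^ 2) * h2A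
  -- All orders of the product are nonnegative, so it is an honest ideal; since ℓ + 1 is even, the
  -- integer division by 2 is exact.
  obtain ⟨I, hI⟩ := exists_coeIdeal_eq_of_count_nonneg (_root_.mul_ne_zero hS hP) fun v => by
    rw [FractionalIdeal.count_mul _ v hS hP, count_span_eq_ord v H.left_ne_zero, key]
    obtain ⟨-, h0, ⟨m, hm⟩, hle⟩ :=
      H.count_discriminantIdeal_of_two_eq_zero hα hF2 hr htop hy h3 hyK G v
    have := ord_algebraMap_nonneg v β₁
    by_cases hv : α ∈ v.asIdeal
    · have := hle hv
      omega
    · rw [ell, if_neg fun h => hv (H.mem_of_ramifies hα hF2 hr htop v h)]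
      have := ord_algebraMap_nonneg v α
      omega
  refine ⟨I, H.isInd_iff hy h3 hyK hF3 ?_ fun v => ?_, hI⟩
  · rintro rfl
    exact _root_.mul_ne_zero hS hP (by rw [← hI]; simp)
  · obtain ⟨e, h0, ⟨m, hm⟩, hle⟩ :=
      H.count_discriminantIdeal_of_two_eq_zero hα hF2 hr htop hy h3 hyK G v
    rw [hI, FractionalIdeal.count_mul _ v hS hP, count_span_eq_ord v H.left_ne_zero, key, e, hD,
      map_pow, ord_pow, hm]
    push_cast
    omega

end CharTwo

end IsNormalForm

end
end CubicFF

theorem mainTheorem3 {F : Type*} [Field F] [Finite F] (p : ℕ) [CharP F p] (hp : p ≠ 3)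
    {L : Type*} [Field L] [Algebra F[X] L] [Algebra (RatFunc F) L]
    [IsScalarTower F[X] (RatFunc F) L]
    [FiniteDimensional (RatFunc F) L] [Algebra.IsSeparable (RatFunc F) L]
    (hL : Module.finrank (RatFunc F) L = 3)
    (a : RatFunc F) (y : L)
    (hy : IntermediateField.adjoin (RatFunc F) {y} = ⊤)
    (hya : y ^ 3 - 3 * y - algebraMap (RatFunc F) L a = 0)
    (α β β₁ β₂ γ : F[X]) (hγ : γ ≠ 0)
    (ha : a = algebraMap F[X] (RatFunc F) α / algebraMap F[X] (RatFunc F) (γ ^ 3 * β))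
    (hcop : IsCoprime α (β * γ))
    (hβ : ∀ d : F[X], d ^ 3 ∣ β → IsUnit d)
    (hβ₁₂ : β = β₁ * β₂ ^ 2) (hβ₁ : Squarefree β₁) (hβ₂ : Squarefree β₂)
    (ω : L) (hω : ω = algebraMap F[X] L (γ * β₁ * β₂) * y) :
    IsIntegral F[X] ω ∧
    (p ≠ 2 → ∀ η₁ η₂ : F[X], Squarefree η₁ →
      4 * γ ^ 6 * β ^ 2 - α ^ 2 = η₁ * η₂ ^ 2 →
        CubicFF.discriminantIdeal F L = Ideal.span {(β₁ * β₂) ^ 2 * η₁} ∧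
        ∀ I : Ideal F[X], CubicFF.IsInd ω I ↔ I = Ideal.span {β₁ * η₂}) ∧
    (p = 2 → ∀ (Q : Type*) [Field Q] [Algebra F[X] Q] [Algebra (RatFunc F) Q]
      [IsScalarTower F[X] (RatFunc F) Q] (r : Q),
      aeval r (CubicFF.quadraticResolvent (X ^ 3 - 3 * X - C a : (RatFunc F)[X])) = 0 →
      IntermediateField.adjoin (RatFunc F) {r} = ⊤ →
        (∃ (η : RatFunc F) (z : Q), CubicFF.IsGlobalStandardForm a α η z) ∧
        ∀ (η : RatFunc F) (z : Q), CubicFF.IsGlobalStandardForm a α η z →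
          ∀ b : RatFunc F, b = 1 / a ^ 2 + 1 + η ^ 2 - η →
            ((CubicFF.discriminantIdeal F L : Ideal F[X]) : FractionalIdeal F[X]⁰ (RatFunc F)) =
              ((Ideal.span {(β₁ * β₂) ^ 2} : Ideal F[X]) : FractionalIdeal F[X]⁰ (RatFunc F)) *
              ∏ᶠ (v : HeightOneSpectrum F[X]) (_ : CubicFF.ord v b < 0 ∧ Odd (CubicFF.ord v b)),
                (v.asIdeal : FractionalIdeal F[X]⁰ (RatFunc F)) ^ (CubicFF.ell v Q b + 1) ∧
            ∃ I : Ideal F[X], (∀ J : Ideal F[X], CubicFF.IsInd ω J ↔ J = I) ∧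
              (I : FractionalIdeal F[X]⁰ (RatFunc F)) =
                ((Ideal.span {β₁} : Ideal F[X]) : FractionalIdeal F[X]⁰ (RatFunc F)) *
                ∏ᶠ (v : HeightOneSpectrum F[X]) (_ : α ∈ v.asIdeal),
                  (v.asIdeal : FractionalIdeal F[X]⁰ (RatFunc F)) ^
                    (CubicFF.ord v (algebraMap F[X] (RatFunc F) α)
                      - (CubicFF.ell v Q b + 1) / 2)) := by
  subst hβ₁₂ hω
  have hyK := CubicFF.notMem_range_of_adjoin_eq_top hL hy
  have hne : γ ^ 3 * (β₁ * β₂ ^ 2) ≠ 0 :=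
    mul_ne_zero (pow_ne_zero 3 hγ) (mul_ne_zero hβ₁.ne_zero (pow_ne_zero 2 hβ₂.ne_zero))
  have H : CubicFF.IsNormalForm a α β₁ β₂ γ :=
    { ne_zero := hγ
      eq := by
        rw [ha, div_mul_cancel₀]
        exact (map_ne_zero_iff _ (IsFractionRing.injective F[X] (RatFunc F))).2 hne
      coprime := hcop
      cubefree := hβ
      squarefree_left := hβ₁
      squarefree_right := hβ₂ }
  have hF3 : (3 : F) ≠ 0 := by
    have h := (CharP.cast_eq_zero_iff F p 3).not.2
      fun h => (CharP.char_is_prime F p).ne_one <|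
        ((Nat.prime_three.eq_one_or_self_of_dvd p h).resolve_right hp)
    simpa using h
  refine ⟨H.isIntegral_gen hya, fun hp2 η₁ η₂ hη₁ hη => ?_, fun hp2 Q _ _ _ _ r hr htop => ?_⟩
  · have hF2 : (2 : F) ≠ 0 := by
      have h := (CharP.cast_eq_zero_iff F p 2).not.2
        fun h => (CharP.char_is_prime F p).ne_one <|
          ((Nat.prime_two.eq_one_or_self_of_dvd p h).resolve_right hp2)
      simpa using h
    exact H.discriminantIdeal_and_isInd_of_two_ne_zero hya hL hyK hF3 hF2 hη₁ hη
  · have hF2 : (2 : F) = 0 := by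
      subst hp2
      exact_mod_cast CharP.cast_eq_zero F 2
    have hα := H.numerator_ne_zero L hya hL hyK
    refine ⟨H.exists_isGlobalStandardForm hα hF2 hr htop, ?_⟩
    rintro η z G b rfl
    exact ⟨H.discriminantIdeal_of_two_eq_zero hα hF2 hr htop hya hL hyK G,
      H.exists_isInd_of_two_eq_zero hα hF2 hr htop hya hL hyK G⟩
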